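/- Let $\Lambda$ be a finite graph with $N$ sites, let $\mathcal H=\bigotimes_{x\in\Lambda}\mathbb C^d$, and let $\mathfrak h^s\subseteq\mathbb C^d$ be a subspace of dimension $d_s=r+1\ge 1$. Let $H^1,\dots,H^r$ be linearly independent, traceless, Hermitian operators on $\mathfrak h^s$ (a basis of a Cartan subalgebra of $\mathfrak{su}(\mathfrak h^s)\otimes\mathbb{C}$), extended by $0$ to $(\mathfrak h^s)^\perp$, that are simultaneously diagonal in an orthonormal basis $|0\rangle,\dots,|r\rangle$ of $\mathfrak h^s$: $H^i|k\rangle=m_k^i|k\rangle$. Let $H^i_x$ denote $H^i$ acting on site $x$, and let $H_X^i=\sum_{x\in X}H_x^i$. Let $P^s$ be the orthogonal projector onto $\mathfrak h^s$ and $P_X^s=\bigotimes_{x\in X}P_x^s$, acting as the identity off $X$. Let $\mathrm{Sym}^N(\mathfrak h^s)$ be the space of permutation-invariant vectors in $\bigotimes_x\mathfrak h^s$. For $k:\Lambda\to\{0,\dots,r\}$ let $\psi_k\propto\sum_{\sigma\in\mathfrak S_\Lambda}\bigotimes_{x}|k_{\sigma(x)}\rangle$ be the totally symmetric weight basis state of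 total weight $m^i(k)=\sum_x m^i_{k_x}$. Let $H=\sum_{X\subseteq\Lambda}h_X$, where $h_X$ acts non-trivially only on the sites of $X$. Call $X$ an interaction region if $h_X\neq0$, and assume that $H$ is local: every interaction region is (non-empty and) connected, and the interaction is not all-to-all, i.e. if $N\ge2$ then there are two distinct sites that lie in no common interaction region. Assume that every $\psi_k$ is an eigenvector of $H$, and that each $P_X^sh_XP_X^s$ is weight preserving: $[P_X^sh_XP_X^s,H_X^i]=0$ for all $X$ and $i$. For $x\in\Lambda$ let $U_x$ be the union of all interaction regions that meet an interaction region containing $x$ (so if all interaction regions have diameter at most $R$, then $U_x$ lies in the ball of radius $2R$ about $x$). Then $$H=\sum_{x\in\Lambda}h^{(1)}_{[x]}P^{(1)}_x+\sum_{\langle x,y\rangle}h^{(2)}_{[xy]}P^{(2)}_{xy}+\sum_{x\in\Lambda}h_x,\qquad h_x=\sum_{i=1}^{r}b_iH_x^i+c ,$$ with $b_1,\dots,b_r,c\in\mathbb C$ independent of $x$, where the second sum runs over the edges of $\Lambda$; $P^{(1)}_x$ and $P^{(2)}_{xy}$ are orthogonal projectors acting non-trivially only on $x$ and on $\{x,y\}$,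 respectively, each of which annihilates $\mathrm{Sym}^N(\mathfrak h^s)$; and the coefficients are strictly local: $h^{(1)}_{[x]}$ acts non-trivially only on $U_x$ and $h^{(2)}_{[xy]}$ only on $U_x\cap U_y$. If $H$ is Hermitian, then so is the Zeeman term $Z=\sum_xh_x$. The Zeeman term alone determines the scar energies: for every $k$, $$H\psi_k=Z\psi_k=\Big(\sum_{i=1}^r b_i\,m^i(k)+Nc\Big)\psi_k .$$ -/

import Mathlib

namespace FerroScar

/-- States of the many-body Hilbert space `⨂_{x ∈ Λ} ℂ^d`, written in the product basis: the basis
is indexed by the configurations `Λ → Fin d`. -/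
abbrev State (Λ : Type*) (d : ℕ) : Type _ := (Λ → Fin d) → ℂ

/-- Operators on `⨂_{x ∈ Λ} ℂ^d`, as matrices in the product basis. -/
abbrev Op (Λ : Type*) (d : ℕ) : Type _ := Matrix (Λ → Fin d) (Λ → Fin d) ℂ

/-- The product state `⨂_x v_x`. -/
def productState {Λ : Type*} [Fintype Λ] {d : ℕ} (v : Λ → EuclideanSpace ℂ (Fin d)) : State Λ d :=
  fun n => ∏ x, v x (n x)

/-- The permutation operator; it sends `⨂_x v_x` to `⨂_x v_{σ x}`. -/
def permute {Λ : Type*} {d : ℕ} (σ : Equiv.Perm Λ) (ψ : State Λ d) : State Λ d :=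
  fun n => ψ (n ∘ σ.symm)

/-- The product operator `⨂_x A_x`. -/
def productOp {Λ : Type*} [Fintype Λ] {d : ℕ} (A : Λ → Matrix (Fin d) (Fin d) ℂ) : Op Λ d :=
  Matrix.of fun n n' => ∏ x, A x (n x) (n' x)

/-- The operator that acts as `A` on site `x` and as the identity on all other sites. -/
def siteOp {Λ : Type*} [Fintype Λ] [DecidableEq Λ] {d : ℕ} (x : Λ)
    (A : Matrix (Fin d) (Fin d) ℂ) : Op Λ d :=
  productOp (Function.update (fun _ => 1) x A)

open Classical in
/-- The operator `A ⊗ 1` that acts as `A` on the sites in `X` and as the identity off `X`. -/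
noncomputable def embed {Λ : Type*} {d : ℕ} (X : Set Λ) (A : Op X d) : Op Λ d :=
  Matrix.of fun n n' =>
    if ∀ y, y ∉ X → n y = n' y then A (fun x => n x) (fun x => n' x) else 0

/-- `O` acts non-trivially only on the sites in `X`. -/
def SupportedOn {Λ : Type*} {d : ℕ} (X : Set Λ) (O : Op Λ d) : Prop :=
  ∃ A : Op X d, O = embed X A

/-- An `(r+1)`-dimensional on-site target space `𝔥ˢ ⊆ ℂ^d` together with a Hermitian basis
`H^1, …, H^r` of a Cartan subalgebra of `𝔰𝔩(𝔥ˢ) = 𝔰𝔲(𝔥ˢ) ⊗ ℂ`. The data are recorded through the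
simultaneous orthonormal eigenbasis `ket k` of `𝔥ˢ` and the eigenvalues,
`H^i (ket k) = weight k i • ket k`. -/
structure TargetSpace (d r : ℕ) where
  /-- the simultaneous eigenstates `|m⟩`, a basis of `𝔥ˢ` -/
  ket : Fin (r + 1) → EuclideanSpace ℂ (Fin d)
  orthonormal : Orthonormal ℂ ket
  /-- the weight vectors of the basis states -/
  weight : Fin (r + 1) → Fin r → ℝ
  /-- the generators `H^i` are traceless -/
  weight_sum : ∀ i, ∑ k, weight k i = 0
  /-- the generators `H^i` are linearly independent -/
  weight_indep : LinearIndependent ℝ (fun (i : Fin r) (k : Fin (r + 1)) => weight k i)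

namespace TargetSpace

variable {d r : ℕ} (T : TargetSpace d r)

/-- The target space `𝔥ˢ` as a subspace of the on-site Hilbert space. -/
def space : Submodule ℂ (EuclideanSpace ℂ (Fin d)) := Submodule.span ℂ (Set.range T.ket)

/-- The rank-one projector `|k⟩⟨k|` on one site. -/
def dyad (k : Fin (r + 1)) : Matrix (Fin d) (Fin d) ℂ :=
  Matrix.of fun a b => T.ket k a * star (T.ket k b)

/-- The orthogonal projector `Pˢ` of the on-site Hilbert space onto `𝔥ˢ`. -/
def proj : Matrix (Fin d) (Fin d) ℂ := ∑ k, T.dyad k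

/-- The Cartan generator `H^i` on one site; it vanishes on the orthogonal complement of `𝔥ˢ`. -/
def cartan (i : Fin r) : Matrix (Fin d) (Fin d) ℂ := ∑ k, (T.weight k i : ℂ) • T.dyad k

variable {Λ : Type*} [Fintype Λ] [DecidableEq Λ]

/-- `P_Xˢ = ⨂_{x ∈ X} P_xˢ`, acting as the identity off `X`. -/
def projOn (X : Finset Λ) : Op Λ d := productOp fun x => if x ∈ X then T.proj else 1

/-- `H_X^i = ∑_{x ∈ X} H_x^i`. -/
def cartanOn (X : Finset Λ) (i : Fin r) : Op Λ d := ∑ x ∈ X, siteOp x (T.cartan i)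

/-- The totally symmetric subspace `Sym^N(𝔥ˢ)`: the permutation-invariant vectors in the span of
the product states with all factors in `𝔥ˢ`. -/
def symSpace (Λ : Type*) [Fintype Λ] : Set (State Λ d) :=
  {ψ | ψ ∈ Submodule.span ℂ {φ | ∃ v : Λ → EuclideanSpace ℂ (Fin d),
      (∀ x, v x ∈ T.space) ∧ φ = productState v} ∧
    ∀ σ : Equiv.Perm Λ, permute σ ψ = ψ}

/-- The totally symmetric weight basis state `∑_σ σ ⨂_x |m_x⟩` of the assignment `x ↦ m_x` of
on-site weights encoded by `k` (without its normalization constant, which does not matter for being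
an eigenstate). It depends on `k` only through the total weight. -/
def weightState (k : Λ → Fin (r + 1)) : State Λ d :=
  ∑ σ : Equiv.Perm Λ, permute σ (productState fun x => T.ket (k x))

/-- The total weight `m^i = ∑_x m_x^i`. -/
def totalWeight (k : Λ → Fin (r + 1)) (i : Fin r) : ℝ := ∑ x, T.weight (k x) i

/-- The Zeeman term `∑_x h_x`, `h_x = ∑_i b_i H_x^i + c`: a site-independent linear combination of
on-site Cartan generators, up to an additive constant. -/
def zeeman (Λ : Type*) [Fintype Λ] [DecidableEq Λ] (b : Fin r → ℂ) (c : ℂ) : Op Λ d :=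
  ∑ x : Λ, (∑ i, b i • siteOp x (T.cartan i) + c • 1)

/-- `P` is an orthogonal projector, acts only on the sites in `X`, and annihilates `Sym^N(𝔥ˢ)`. -/
def IsLocalAnnihilatingProjector (X : Set Λ) (P : Op Λ d) : Prop :=
  IsStarProjection P ∧ SupportedOn X P ∧ ∀ ψ ∈ T.symSpace Λ, P.mulVec ψ = 0

end TargetSpace

/-- The interaction `X ↦ h_X` is local on the lattice (graph) `G`: every term `h_X` acts only on
`X`, only connected regions `X` carry a non-zero term, and the interaction is not all-to-all, i.e.
(unless there is at most one site) some two sites lie in no common region with a non-zero term. -/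
structure IsLocal {Λ : Type*} {d : ℕ} (G : SimpleGraph Λ) (h : Finset Λ → Op Λ d) : Prop where
  supported : ∀ X : Finset Λ, SupportedOn (X : Set Λ) (h X)
  connected : ∀ X : Finset Λ, h X ≠ 0 → (G.induce (X : Set Λ)).Connected
  not_all_to_all : Nontrivial Λ →
    ∃ x y : Λ, x ≠ y ∧ ∀ X : Finset Λ, h X ≠ 0 → ¬ (x ∈ X ∧ y ∈ X)

/-- The union of all interaction regions that meet an interaction region containing `x`. If all
interaction regions have diameter at most `R`, it lies in the ball of radius `2R` about `x`. -/
def interactionHull {Λ : Type*} {d : ℕ} (h : Finset Λ → Op Λ d) (x : Λ) : Set Λ :=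
  {z | ∃ X Y : Finset Λ, h X ≠ 0 ∧ h Y ≠ 0 ∧ x ∈ X ∧ z ∈ Y ∧ ∃ w, w ∈ X ∧ w ∈ Y}

end FerroScar

open FerroScar

/-!
On a connected region, a state lies in `Sym^N(𝔥ˢ)` as soon as it is annihilated by the projectors
onto leaving `𝔥ˢ` at one site and by the antisymmetrizers of the edges, because transpositions along
edges generate the symmetric group. By duality an operator on the region that annihilates
`Sym^N(𝔥ˢ)` is a combination of these projectors with coefficients on the region, and by
polarization it is enough that it annihilates the coherent states `⨂_x v` with `v ∈ 𝔥ˢ`. So it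
remains to subtract from `H` a Zeeman term in such a way that the rest is a sum of terms of this
kind on connected regions.

Sort each `h_X` by the set `Y` of the sites that it moves out of `𝔥ˢ`. For `Y ≠ ∅` the sum over all
regions `X ⊇ Y` annihilates the coherent states, because `H` preserves `Sym^N(𝔥ˢ)`; these regions
share a site, hence their union is connected. What is left are the operators `P_Xˢ h_X`. Weight
preservation makes each of them act on coherent states as a diagonal operator on `X`, the entries of
which are its amplitudes. The total amplitude of `H` is a symmetric function of the configuration,
and has no correlation between two sites that share no region; by symmetry it then has none between
any two sites, so it is a sum of equal functions of single sites. Every function of the on-site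
state is affine in the weights since the generators are linearly independent and traceless, and this
gives the Zeeman term.
-/

namespace FerroScar

open Finset Function Matrix

section LinearAlgebra

theorem sum_comp_perm_eq_zero_of_diagonal {R ι M N : Type*} [CommRing R] [Fintype ι]
    [DecidableEq ι] [AddCommGroup M] [Module R M] [AddCommGroup N] [Module R N]
    (f : MultilinearMap R (fun _ : ι => M) N) (hf : ∀ v, f (fun _ => v) = 0) (u : ι → M) :
    ∑ σ : Equiv.Perm ι, f (u ∘ σ) = 0 := by
  -- Inclusion–exclusion over the values missed by `g` isolates the bijective `g`; the sum over all
  -- `g` with values off `t` is `f` on the diagonal, at `∑ i ∈ tᶜ, u i`.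
  let avoiding (i : ι) : Finset (ι → ι) := {g | ∀ j, g j ≠ i}
  have sum_avoiding (t : Finset ι) : ∑ g ∈ t.inf avoiding, f (u ∘ g) = 0 := by
    have inf_avoiding : t.inf avoiding = Fintype.piFinset fun _ => tᶜ := by
      ext g
      simp only [avoiding, mem_inf, mem_filter_univ, Fintype.mem_piFinset, mem_compl]
      exact ⟨fun h j hj => h _ hj j rfl, fun h i hi j hj => h j (hj ▸ hi)⟩
    rw [inf_avoiding, ← hf (∑ i ∈ tᶜ, u i)]
    exact (f.map_sum_finset (fun _ => u) fun _ => tᶜ).symm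
  have surjective_of_mem {g : ι → ι} (hg : g ∈ univ.inf fun i => (avoiding i)ᶜ) :
      Surjective g := by
    simpa [avoiding, mem_inf, Surjective] using hg
  calc ∑ σ : Equiv.Perm ι, f (u ∘ σ)
      = ∑ g ∈ univ.inf fun i => (avoiding i)ᶜ, f (u ∘ g) := by
        refine sum_bij (fun σ _ => ⇑σ) (fun σ _ => ?_) (fun _ _ _ _ h => Equiv.coe_fn_injective h)
          (fun g hg => ⟨.ofBijective g (Finite.surjective_iff_bijective.mp (surjective_of_mem hg)),
            mem_univ _, rfl⟩) fun _ _ => rfl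
        simp only [avoiding, mem_inf, mem_compl, mem_filter_univ, not_forall, not_not]
        exact fun i _ => σ.surjective i
    _ = ∑ t ∈ univ.powerset, (-1) ^ #t • ∑ g ∈ t.inf avoiding, f (u ∘ g) :=
        inclusion_exclusion_sum_inf_compl univ avoiding fun g => f (u ∘ g)
    _ = 0 := sum_eq_zero fun t _ => by rw [sum_avoiding, smul_zero]

theorem mem_leftIdeal_span_of_common_kernel {K m : Type*} [Field K] [Fintype m] [DecidableEq m]
    {S : Set (Matrix m m K)} {A : Matrix m m K}
    (h : ∀ φ, (∀ P ∈ S, P *ᵥ φ = 0) → A *ᵥ φ = 0) : A ∈ Ideal.span S := by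
  let placeInRow (i : m) : Module.Dual K (m → K) →ₗ[K] Matrix m m K :=
    (vecMulVecBilin K K (Pi.single i 1)) ∘ₗ (dotProductEquiv K m).symm.toLinearMap
  have place_row (i : m) (v : m → K) :
      placeInRow i (dotProductEquiv K m v) = vecMulVec (Pi.single i 1) v := by
    simp [placeInRow]
  have row_mem (i : m) : dotProductEquiv K m (A i) ∈
      Submodule.span K (Set.range fun p : S × m => dotProductEquiv K m (p.1.1 p.2)) := by
    refine FiniteDimensional.mem_span_of_iInf_ker_le_ker fun φ hφ => ?_
    refine congr_fun (h φ fun P hP => ?_) i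
    ext k
    exact LinearMap.mem_ker.mp (Submodule.mem_iInf _ |>.mp hφ (⟨P, hP⟩, k))
  have place_row_mem (i : m) : vecMulVec (Pi.single i 1) (A i) ∈ Ideal.span S := by
    rw [← place_row]
    suffices Submodule.span K (Set.range fun p : S × m => dotProductEquiv K m (p.1.1 p.2)) ≤
        ((Ideal.span S).restrictScalars K).comap (placeInRow i) from this (row_mem i)
    rw [Submodule.span_le]
    rintro _ ⟨⟨⟨P, hP⟩, k⟩, rfl⟩
    have : vecMulVec (Pi.single i 1) (P k) = single i k 1 * P := by
      ext a b
      simp [vecMulVec_apply, mul_apply, single_apply, Pi.single_apply, eq_comm, ite_and]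
    simpa [place_row, this] using Ideal.mul_mem_left _ _ (Ideal.subset_span hP)
  have sum_rows : A = ∑ i, vecMulVec (Pi.single i 1) (A i) := by
    ext a b
    simp [Matrix.sum_apply, vecMulVec_apply, Pi.single_apply]
  rw [sum_rows]
  exact sum_mem fun i _ => place_row_mem i

theorem star_eq_self_of_isHermitian {𝕜 m : Type*} [RCLike 𝕜] [Fintype m]
    {A : Matrix m m 𝕜}
    (hA : A.IsHermitian) {μ : 𝕜} {v : m → 𝕜} (hv : A *ᵥ v = μ • v) (hv0 : v ≠ 0) :
    star μ = μ := by
  have norm_ne_zero : star v ⬝ᵥ v ≠ 0 := by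
    open scoped ComplexOrder in exact mt dotProduct_star_self_eq_zero.mp hv0
  have move : star (A *ᵥ v) ⬝ᵥ v = star v ⬝ᵥ A *ᵥ v := by
    rw [star_mulVec, hA.eq, dotProduct_mulVec]
  rw [hv, star_smul, smul_dotProduct, dotProduct_smul] at move
  exact smul_left_injective 𝕜 norm_ne_zero move

end LinearAlgebra

section Uncorrelated

variable {Λ κ M : Type*} [DecidableEq Λ] [AddCommGroup M]

/-- The function `F` of configurations has no correlation between the sites `x` and `y`: all its
mixed differences in these two sites vanish. -/
def Uncorrelated (F : (Λ → κ) → M) (x y : Λ) : Prop :=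
  ∀ (n : Λ → κ) (a b : κ),
    F (update (update n x a) y b) + F n = F (update n x a) + F (update n y b)

theorem Uncorrelated.sum {ι : Type*} {s : Finset ι} {F : ι → (Λ → κ) → M} {x y : Λ}
    (hF : ∀ i ∈ s, Uncorrelated (F i) x y) : Uncorrelated (∑ i ∈ s, F i) x y := fun n a b => by
  simp only [Finset.sum_apply, ← sum_add_distrib]
  exact sum_congr rfl fun i hi => hF i hi n a b

theorem uncorrelated_of_dependsOn {F : (Λ → κ) → M} {s : Set Λ} (hF : DependsOn F s) {x y : Λ}
    (hxy : x ≠ y) (hs : ¬ (x ∈ s ∧ y ∈ s)) : Uncorrelated F x y := by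
  have update_eq {z : Λ} (hz : z ∉ s) (n : Λ → κ) (c : κ) : F (update n z c) = F n :=
    hF fun w hw => update_of_ne (ne_of_mem_of_not_mem hw hz) _ _
  intro n a b
  by_cases hx : x ∈ s
  · rw [update_eq fun hy => hs ⟨hx, hy⟩, update_eq fun hy => hs ⟨hx, hy⟩]
  · rw [update_comm hxy, update_eq hx, update_eq hx, add_comm]

/-- A function of configurations is symmetric if relabelling the sites does not change it. -/
def IsSymmetric (F : (Λ → κ) → M) : Prop :=
  ∀ (σ : Equiv.Perm Λ) (n : Λ → κ), F (n ∘ σ) = F n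

theorem Uncorrelated.of_isSymmetric {F : (Λ → κ) → M} (hF : IsSymmetric F) {x₀ y₀ x y : Λ}
    (h₀ : Uncorrelated F x₀ y₀) (hxy₀ : x₀ ≠ y₀) (hxy : x ≠ y) : Uncorrelated F x y := by
  obtain ⟨σ, rfl, rfl⟩ := MulAction.is_two_pretransitive_iff.mp
    (Equiv.Perm.isMultiplyPretransitive Λ 2) hxy₀ hxy
  have relabel (n : Λ → κ) (z : Λ) (c : κ) : update (n ∘ σ) z c = update n (σ • z) c ∘ σ := by
    rw [update_comp_equiv, Equiv.Perm.smul_def, Equiv.symm_apply_apply]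
  intro n a b
  simpa only [relabel, hF σ] using h₀ (n ∘ σ) a b

variable [Fintype Λ]

theorem eq_add_sum_of_uncorrelated {F : (Λ → κ) → M} (hF : ∀ x y, x ≠ y → Uncorrelated F x y)
    (n₀ n : Λ → κ) : F n = F n₀ + ∑ x, (F (update n₀ x (n x)) - F n₀) := by
  have add_site {y : Λ} (b : κ) (S : Finset Λ) (hy : y ∉ S) :
      F (update (S.piecewise n n₀) y b) + F n₀ = F (S.piecewise n n₀) + F (update n₀ y b) := by
    induction S using Finset.induction_on with
    | empty => rw [piecewise_empty, add_comm]
    | insert x S _ ih =>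
      rw [mem_insert, not_or] at hy
      have mixed := hF x y (Ne.symm hy.1) (S.piecewise n n₀) (n x) b
      rw [piecewise_insert, ← add_left_inj (F (S.piecewise n n₀)), add_right_comm, mixed,
        add_assoc, ih hy.2, add_assoc, add_comm (F (update n₀ y b))]
  have eq_on (S : Finset Λ) :
      F (S.piecewise n n₀) = F n₀ + ∑ x ∈ S, (F (update n₀ x (n x)) - F n₀) := by
    induction S using Finset.induction_on with
    | empty => rw [piecewise_empty, sum_empty, add_zero]
    | insert y S hy ih =>
      rw [piecewise_insert, sum_insert hy, eq_sub_of_add_eq (add_site (n y) S hy), ih]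
      abel
  simpa only [piecewise_univ] using eq_on univ

theorem exists_eq_sum_of_isSymmetric [Nonempty Λ] [Nonempty κ] [Module ℚ M] {F : (Λ → κ) → M}
    (hF : IsSymmetric F) (hunc : ∀ x y, x ≠ y → Uncorrelated F x y) :
    ∃ ε : κ → M, ∀ n, F n = ∑ x, ε (n x) := by
  obtain ⟨x₀⟩ := ‹Nonempty Λ›
  obtain ⟨a₀⟩ := ‹Nonempty κ›
  let n₀ : Λ → κ := fun _ => a₀
  have site_indep (x : Λ) (a : κ) : F (update n₀ x a) = F (update n₀ x₀ a) := by
    rw [← hF (Equiv.swap x₀ x) (update n₀ x a), update_comp_equiv, Equiv.symm_swap,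
      Equiv.swap_apply_right]
    rfl
  have hcard : (Fintype.card Λ : ℚ) ≠ 0 := Nat.cast_ne_zero.mpr (Fintype.card_pos_iff.mpr ⟨x₀⟩).ne'
  refine ⟨fun a => (Fintype.card Λ : ℚ)⁻¹ • F n₀ + (F (update n₀ x₀ a) - F n₀), fun n => ?_⟩
  rw [eq_add_sum_of_uncorrelated hunc n₀ n, sum_add_distrib, sum_const, card_univ,
    ← Nat.cast_smul_eq_nsmul ℚ, smul_inv_smul₀ hcard]
  simp only [site_indep]

end Uncorrelated

section Tensor

variable {Λ : Type*} [Fintype Λ] {d : ℕ}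

/-- The product vector `⨂_x v_x` of plain coordinate vectors, as a multilinear map. -/
def tensorVec (Λ : Type*) [Fintype Λ] (d : ℕ) :
    MultilinearMap ℂ (fun _ : Λ => Fin d → ℂ) (State Λ d) :=
  MultilinearMap.pi fun n =>
    (MultilinearMap.mkPiAlgebra ℂ Λ ℂ).compLinearMap fun x => LinearMap.proj (n x)

/-- The multilinear dependence of `productOp A` on its factors. -/
def productOpMultilinear (Λ : Type*) [Fintype Λ] (d : ℕ) :
    MultilinearMap ℂ (fun _ : Λ => Matrix (Fin d) (Fin d) ℂ) (Op Λ d) :=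
  MultilinearMap.pi fun n => MultilinearMap.pi fun n' =>
    (MultilinearMap.mkPiAlgebra ℂ Λ ℂ).compLinearMap fun x => entryLinearMap ℂ ℂ (n x) (n' x)

theorem productOpMultilinear_apply (A : Λ → Matrix (Fin d) (Fin d) ℂ) :
    productOpMultilinear Λ d A = productOp A := rfl

theorem tensorVec_apply (v : Λ → Fin d → ℂ) (n : Λ → Fin d) :
    tensorVec Λ d v n = ∏ x, v x (n x) := rfl

theorem productOp_apply (A : Λ → Matrix (Fin d) (Fin d) ℂ) (n n' : Λ → Fin d) :
    productOp A n n' = ∏ x, A x (n x) (n' x) := rfl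

theorem productOp_one : productOp (fun _ : Λ => (1 : Matrix (Fin d) (Fin d) ℂ)) = 1 := by
  ext n n'
  simp only [productOp_apply, one_apply, Fintype.prod_boole, funext_iff]

theorem productOp_conjTranspose (A : Λ → Matrix (Fin d) (Fin d) ℂ) :
    (productOp A)ᴴ = productOp fun x => (A x)ᴴ := by
  ext n n'
  simp only [conjTranspose_apply, productOp_apply, star_prod]

variable [DecidableEq Λ]

theorem productOp_mul (A B : Λ → Matrix (Fin d) (Fin d) ℂ) :
    productOp A * productOp B = productOp fun x => A x * B x := by
  ext n n'
  simp only [mul_apply, productOp_apply, ← prod_mul_distrib, prod_univ_sum,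
    Fintype.piFinset_univ]

theorem productOp_mulVec (A : Λ → Matrix (Fin d) (Fin d) ℂ) (v : Λ → Fin d → ℂ) :
    productOp A *ᵥ tensorVec Λ d v = tensorVec Λ d fun x => A x *ᵥ v x := by
  ext n
  simp only [mulVec, dotProduct, productOp_apply, tensorVec_apply, ← prod_mul_distrib,
    prod_univ_sum, Fintype.piFinset_univ]

theorem vecMul_productOp (A : Λ → Matrix (Fin d) (Fin d) ℂ) (v : Λ → Fin d → ℂ) :
    tensorVec Λ d v ᵥ* productOp A = tensorVec Λ d fun x => v x ᵥ* A x := by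
  ext n
  simp only [vecMul, dotProduct, productOp_apply, tensorVec_apply, ← prod_mul_distrib,
    prod_univ_sum, Fintype.piFinset_univ]

theorem tensorVec_dotProduct (v w : Λ → Fin d → ℂ) :
    tensorVec Λ d v ⬝ᵥ tensorVec Λ d w = ∏ x, v x ⬝ᵥ w x := by
  simp only [dotProduct, tensorVec_apply, ← prod_mul_distrib, prod_univ_sum,
    Fintype.piFinset_univ]

theorem siteOp_mul (x : Λ) (A B : Matrix (Fin d) (Fin d) ℂ) :
    siteOp x (A * B) = siteOp x A * siteOp x B := by
  rw [siteOp, siteOp, siteOp, productOp_mul]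
  congr 1
  ext1 y
  rw [← Pi.mul_apply, ← Pi.one_def, ← Pi.mulSingle, ← Pi.mulSingle, ← Pi.mulSingle,
    Pi.mulSingle_mul]

theorem siteOp_conjTranspose (x : Λ) (A : Matrix (Fin d) (Fin d) ℂ) :
    (siteOp x A)ᴴ = siteOp x Aᴴ := by
  rw [siteOp, siteOp, productOp_conjTranspose]
  congr 1
  ext1 y
  rw [apply_update fun _ => conjTranspose]
  simp only [conjTranspose_one]

/-- The embedding of the one-site matrix algebra at the site `x`. -/
def siteOpHom (Λ : Type*) [Fintype Λ] [DecidableEq Λ] (d : ℕ) (x : Λ) :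
    Matrix (Fin d) (Fin d) ℂ →⋆ₐ[ℂ] Op Λ d where
  __ := AlgHom.ofLinearMap ((productOpMultilinear Λ d).toLinearMap (fun _ => 1) x)
    (by simp [productOpMultilinear_apply, productOp_one]) (siteOp_mul x)
  map_star' A := (siteOp_conjTranspose x A).symm

theorem siteOpHom_apply (x : Λ) (A : Matrix (Fin d) (Fin d) ℂ) :
    siteOpHom Λ d x A = siteOp x A := rfl

theorem siteOp_mulVec (x : Λ) (A : Matrix (Fin d) (Fin d) ℂ) (v : Λ → Fin d → ℂ) :
    siteOp x A *ᵥ tensorVec Λ d v = tensorVec Λ d (update v x (A *ᵥ v x)) := by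
  rw [siteOp, productOp_mulVec]
  congr 1
  ext1 y
  obtain rfl | hy := eq_or_ne y x <;> simp [*]

theorem vecMul_siteOp (x : Λ) (A : Matrix (Fin d) (Fin d) ℂ) (v : Λ → Fin d → ℂ) :
    tensorVec Λ d v ᵥ* siteOp x A = tensorVec Λ d (update v x (v x ᵥ* A)) := by
  rw [siteOp, vecMul_productOp]
  congr 1
  ext1 y
  obtain rfl | hy := eq_or_ne y x <;> simp [*]

end Tensor

section LocalAlgebra

variable {Λ : Type*} {d : ℕ} {X Y : Set Λ}

open scoped Classical in
/-- The splitting of configurations into their parts on and off the region `X`. -/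
noncomputable def splitConf (d : ℕ) (X : Set Λ) :
    (Λ → Fin d) ≃ (X → Fin d) × ({y // y ∉ X} → Fin d) :=
  Equiv.piEquivPiSubtypeProd (· ∈ X) fun _ => Fin d

theorem splitConf_apply (n : Λ → Fin d) :
    splitConf d X n = (fun x : X => n x, fun y : {y // y ∉ X} => n y) := rfl

open scoped Kronecker in
theorem embed_eq_submatrix_kronecker [DecidableEq ({y // y ∉ X} → Fin d)] (A : Op X d) :
    embed X A =
      (A ⊗ₖ (1 : Op {y // y ∉ X} d)).submatrix (splitConf d X) (splitConf d X) := by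
  ext n n'
  simp only [embed, of_apply, submatrix_apply, kroneckerMap_apply, one_apply, mul_ite, mul_one,
    mul_zero, splitConf_apply]
  congr! 1
  simp only [funext_iff, Subtype.forall]

open scoped Kronecker in
theorem embed_compl_eq_submatrix_kronecker [DecidableEq (X → Fin d)] (B : Op (Xᶜ : Set Λ) d) :
    embed Xᶜ B =
      ((1 : Op X d) ⊗ₖ (show Op {y // y ∉ X} d from B)).submatrix
        (splitConf d X) (splitConf d X) := by
  ext n n'
  simp only [embed, of_apply, submatrix_apply, kroneckerMap_apply, one_apply, ite_mul, one_mul,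
    zero_mul, splitConf_apply]
  congr! 1
  simp only [funext_iff, Subtype.forall, Set.mem_compl_iff, not_not]

variable [Fintype Λ]

theorem productOp_eq_embed [Fintype X] {A : Λ → Matrix (Fin d) (Fin d) ℂ} (hA : ∀ x ∉ X, A x = 1) :
    productOp A = embed X (productOp fun x : X => A x) := by
  classical
  ext n n'
  simp only [embed, productOp_apply, of_apply]
  rw [← Fintype.prod_subtype_mul_prod_subtype (· ∈ X)]
  have off_one : ∏ y : {y // y ∉ X}, A y (n y) (n' y) = if ∀ y ∉ X, n y = n' y then 1 else 0 := by
    simp only [hA _ (Subtype.prop (p := fun y => y ∉ X) _), one_apply, Fintype.prod_boole,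
      Subtype.forall]
  rw [off_one, mul_ite, mul_one, mul_zero]
  congr!

theorem tensorVec_eq_mul_tensorVec [Fintype X] [Fintype {y // y ∉ X}] (v : Λ → Fin d → ℂ)
    (n : Λ → Fin d) :
    tensorVec Λ d v n = tensorVec X d (fun x => v x) (splitConf d X n).1 *
      tensorVec {y // y ∉ X} d (fun y => v y) (splitConf d X n).2 := by
  classical
  simp only [tensorVec_apply, splitConf_apply]
  rw [← Fintype.prod_subtype_mul_prod_subtype (· ∈ X)]
  congr!

theorem embed_one [Fintype X] : embed X (1 : Op X d) = 1 := by
  classical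
  rw [embed_eq_submatrix_kronecker, one_kronecker_one, submatrix_one_equiv]

variable [DecidableEq Λ]

theorem embed_mul [Fintype X] (A B : Op X d) : embed X (A * B) = embed X A * embed X B := by
  classical
  rw [embed_eq_submatrix_kronecker, embed_eq_submatrix_kronecker, embed_eq_submatrix_kronecker,
    submatrix_mul_equiv, ← mul_kronecker_mul, one_mul]

/-- The embedding `A ↦ A ⊗ 1` of the operators on the region `X`. -/
noncomputable def embedHom (d : ℕ) (X : Set Λ) [Fintype X] : Op X d →ₐ[ℂ] Op Λ d :=
  AlgHom.ofLinearMap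
    { toFun := embed X
      map_add' A B := by classical simp only [embed_eq_submatrix_kronecker, add_kronecker]; rfl
      map_smul' c A := by classical simp only [embed_eq_submatrix_kronecker, smul_kronecker]; rfl }
    embed_one embed_mul

theorem embedHom_apply [Fintype X] (A : Op X d) : embedHom d X A = embed X A := rfl

open scoped Classical in
/-- The algebra of the operators that act non-trivially only on the sites in `X`. -/
noncomputable def localAlgebra (d : ℕ) (X : Set Λ) : Subalgebra ℂ (Op Λ d) :=
  (embedHom d X).range.copy {O | SupportedOn X O} <| by
    ext
    simp [SupportedOn, embedHom_apply, eq_comm]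

theorem embed_mem_localAlgebra (A : Op X d) : embed X A ∈ localAlgebra d X := ⟨A, rfl⟩

theorem localAlgebra_mono (hXY : X ⊆ Y) : localAlgebra d X ≤ localAlgebra d Y := by
  classical
  rintro _ ⟨A, rfl⟩
  refine ⟨embed {y : Y | (y : Λ) ∈ X} (A.submatrix (fun n x => n ⟨⟨x, hXY x.2⟩, x.2⟩)
    fun n x => n ⟨⟨x, hXY x.2⟩, x.2⟩), ?_⟩
  ext n n'
  simp only [embed, of_apply, submatrix_apply, ← ite_and, Subtype.forall, Set.mem_ofPred_eq]
  congr 1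
  refine propext ⟨fun h => ⟨fun y hy => h y fun hx => hy (hXY hx), fun y _ => h y⟩,
    fun h y hy => ?_⟩
  by_cases hyY : y ∈ Y
  exacts [h.2 y hyY hy, h.1 y hyY]

theorem commute_of_disjoint (hXY : Disjoint X Y) {O O' : Op Λ d} (hO : O ∈ localAlgebra d X)
    (hO' : O' ∈ localAlgebra d Y) : Commute O O' := by
  classical
  obtain ⟨A, rfl⟩ := hO
  obtain ⟨B, rfl⟩ := localAlgebra_mono hXY.subset_compl_left hO'
  rw [Commute, SemiconjBy, embed_eq_submatrix_kronecker, embed_compl_eq_submatrix_kronecker,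
    submatrix_mul_equiv, submatrix_mul_equiv, ← mul_kronecker_mul, ← mul_kronecker_mul,
    mul_one, mul_one, one_mul, one_mul]

theorem productOp_mem_localAlgebra {A : Λ → Matrix (Fin d) (Fin d) ℂ} (hA : ∀ x ∉ X, A x = 1) :
    productOp A ∈ localAlgebra d X := by
  classical
  rw [productOp_eq_embed hA]
  exact embed_mem_localAlgebra _

theorem siteOp_mem_localAlgebra (x : Λ) (A : Matrix (Fin d) (Fin d) ℂ) :
    siteOp x A ∈ localAlgebra d {x} :=
  productOp_mem_localAlgebra fun _ hy => update_of_ne hy _ _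

theorem embed_siteOp [Fintype X] (x : X) (A : Matrix (Fin d) (Fin d) ℂ) :
    embed X (siteOp x A) = siteOp (x : Λ) A := by
  rw [siteOp, siteOp, productOp_eq_embed (X := X) fun y hy => update_of_ne (by grind) _ _]
  congr 2
  ext1 y
  simp [update_apply, Subtype.ext_iff]

theorem embed_mulVec_tensorVec [Fintype X] [Fintype {y // y ∉ X}] (A : Op X d) (v : Λ → Fin d → ℂ)
    (n : Λ → Fin d) :
    (embed X A *ᵥ tensorVec Λ d v) n = (A *ᵥ tensorVec X d fun x => v x) (splitConf d X n).1 *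
      tensorVec {y // y ∉ X} d (fun y => v y) (splitConf d X n).2 := by
  classical
  rw [embed_eq_submatrix_kronecker, submatrix_mulVec_equiv]
  simp only [Function.comp_apply, mulVec, dotProduct, Fintype.sum_prod_type, kroneckerMap_apply,
    one_apply, mul_ite, mul_one, mul_zero, ite_mul, zero_mul, sum_ite_eq, mem_univ, if_true,
    sum_mul, tensorVec_eq_mul_tensorVec (X := X), Equiv.apply_symm_apply, mul_assoc]

theorem tensorVec_dotProduct_embed_mulVec [Fintype X] [Fintype {y // y ∉ X}] (A : Op X d)
    (u v : Λ → Fin d → ℂ) :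
    tensorVec Λ d u ⬝ᵥ embed X A *ᵥ tensorVec Λ d v =
      (tensorVec X d (fun x => u x) ⬝ᵥ A *ᵥ tensorVec X d fun x => v x) *
        ∏ y : {y // y ∉ X}, u y ⬝ᵥ v y := by
  rw [← tensorVec_dotProduct, dotProduct, dotProduct, dotProduct, sum_mul_sum,
    ← Fintype.sum_prod_type', ← (splitConf d X).sum_comp]
  refine sum_congr rfl fun n _ => ?_
  rw [embed_mulVec_tensorVec, tensorVec_eq_mul_tensorVec (X := X)]
  ring

end LocalAlgebra

section LabelOp

variable {Λ κ : Type*} [Fintype Λ] [DecidableEq Λ] [Fintype κ] {d : ℕ}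
  {L : κ → Matrix (Fin d) (Fin d) ℂ}

/-- The operator `∑_n f(n) ⨂_x L_{n_x}`; it is diagonal with entries `f` if `L` is a family of
orthogonal projectors. -/
def labelOp (Λ : Type*) [Fintype Λ] [DecidableEq Λ] (L : κ → Matrix (Fin d) (Fin d) ℂ) :
    ((Λ → κ) → ℂ) →ₗ[ℂ] Op Λ d :=
  Fintype.linearCombination ℂ fun n => productOp fun x => L (n x)

theorem labelOp_prod (g : Λ → κ → ℂ) :
    labelOp Λ L (fun n => ∏ x, g x (n x)) = productOp fun x => ∑ k, g x k • L k := by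
  refine Eq.trans ?_ ((productOpMultilinear Λ d).map_sum fun x k => g x k • L k).symm
  exact sum_congr rfl fun n _ =>
    ((productOpMultilinear Λ d).map_smul_univ (fun x => g x (n x)) fun x => L (n x)).symm

theorem labelOp_sum (hL : ∑ k, L k = 1) (ε : κ → ℂ) :
    labelOp Λ L (fun n => ∑ x, ε (n x)) = ∑ x, siteOp x (∑ k, ε k • L k) := by
  have sum_eq : (fun n : Λ → κ => ∑ x, ε (n x)) =
      ∑ x, fun n => ∏ z, (if z = x then ε else 1) (n z) := by
    ext n
    simp [ite_apply]
  rw [sum_eq, map_sum]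
  refine sum_congr rfl fun x _ => ?_
  rw [labelOp_prod, siteOp]
  congr 1
  ext1 z
  obtain rfl | hz := eq_or_ne z x
  · simp
  · simp [hz, hL]

theorem labelOp_mem_localAlgebra (hL : ∑ k, L k = 1) {X : Set Λ} {f : (Λ → κ) → ℂ}
    (hf : DependsOn f X) : labelOp Λ L f ∈ localAlgebra d X := by
  classical
  obtain ⟨g, rfl⟩ := dependsOn_iff_exists_comp.mp hf
  have expand : g ∘ X.domRestrict =
      ∑ m : X → κ, g m • fun n : Λ → κ => ∏ x, if ∀ hx : x ∈ X, n x = m ⟨x, hx⟩ then 1 else 0 := by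
    ext n
    have eq_iff (m : X → κ) : (∀ x, ∀ hx : x ∈ X, n x = m ⟨x, hx⟩) ↔ X.domRestrict n = m :=
      ⟨fun h => funext fun x => h x x.2, by rintro rfl x _; rfl⟩
    simp [Finset.sum_apply, Fintype.prod_boole, eq_iff]
  rw [expand, map_sum]
  refine sum_mem fun m _ => ?_
  rw [map_smul, labelOp_prod fun x k => if ∀ hx : x ∈ X, k = m ⟨x, hx⟩ then 1 else 0]
  exact Subalgebra.smul_mem _ (productOp_mem_localAlgebra fun x hx => by simp [hx, hL]) _

end LabelOp

section Permutation

variable {Λ : Type*} {d : ℕ}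

theorem permute_permute (σ τ : Equiv.Perm Λ) (ψ : State Λ d) :
    permute σ (permute τ ψ) = permute (τ * σ) ψ := rfl

/-- The subgroup of the permutations of the sites that leave a state invariant. -/
def fixingPerms (ψ : State Λ d) : Subgroup (Equiv.Perm Λ) where
  carrier := {σ | permute σ ψ = ψ}
  one_mem' := rfl
  mul_mem' {σ τ} (hσ : permute σ ψ = ψ) (hτ : permute τ ψ = ψ) := by
    rw [Set.mem_ofPred_eq, ← permute_permute, hσ, hτ]
  inv_mem' {σ} (hσ : permute σ ψ = ψ) := by
    rw [Set.mem_ofPred_eq]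
    conv_lhs => rw [← hσ, permute_permute, mul_inv_cancel]
    rfl

theorem mem_fixingPerms {ψ : State Λ d} {σ : Equiv.Perm Λ} :
    σ ∈ fixingPerms ψ ↔ permute σ ψ = ψ := Iff.rfl

theorem fixingPerms_eq_top_of_preconnected [Finite Λ] [DecidableEq Λ] {G : SimpleGraph Λ}
    (hG : G.Preconnected) {ψ : State Λ d}
    (hψ : ∀ x y, G.Adj x y → permute (Equiv.swap x y) ψ = ψ) : fixingPerms ψ = ⊤ := by
  rw [eq_top_iff, ← Equiv.Perm.closure_isSwap, Subgroup.closure_le]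
  rintro _ ⟨x, y, -, rfl⟩
  obtain ⟨w⟩ := hG x y
  induction w with
  | nil => rw [Equiv.swap_self]; exact one_mem (fixingPerms ψ)
  | cons hadj _ ih => exact SubmonoidClass.swap_mem_trans _ (hψ _ _ hadj) ih

variable [Fintype Λ]

theorem permute_tensorVec (σ : Equiv.Perm Λ) (v : Λ → Fin d → ℂ) :
    permute σ (tensorVec Λ d v) = tensorVec Λ d (v ∘ σ) := by
  ext n
  simp only [permute, tensorVec_apply, Function.comp_apply]
  exact Fintype.prod_equiv σ.symm _ _ fun x => by rw [Equiv.apply_symm_apply]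

/-- The matrix of `permute σ`. -/
def permOp (d : ℕ) (σ : Equiv.Perm Λ) : Op Λ d :=
  Equiv.Perm.permMatrix ℂ (σ.arrowCongr (Equiv.refl (Fin d)))

theorem permOp_apply (σ : Equiv.Perm Λ) (n n' : Λ → Fin d) :
    permOp d σ n n' = if n = n' ∘ σ then 1 else 0 := by
  rw [permOp, Equiv.Perm.permMatrix, PEquiv.toMatrix_apply]
  simp [Equiv.arrowCongr, Equiv.comp_symm_eq]

theorem embed_permOp {X : Set Λ} [Fintype X] [DecidablePred (· ∈ X)] (σ : Equiv.Perm X) :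
    embed X (permOp d σ) = permOp d (Equiv.Perm.ofSubtype σ) := by
  ext n n'
  simp only [embed, of_apply, permOp_apply, ← ite_and, funext_iff, Function.comp_apply]
  congr 1
  refine propext ⟨fun ⟨hoff, hon⟩ y => ?_, fun h => ⟨fun y hy => ?_, fun x => ?_⟩⟩
  · by_cases hy : y ∈ X
    · rw [Equiv.Perm.ofSubtype_apply_of_mem σ hy, ← hon ⟨y, hy⟩]
    · rw [Equiv.Perm.ofSubtype_apply_of_not_mem σ hy, hoff y hy]
  · rw [h, Equiv.Perm.ofSubtype_apply_of_not_mem σ hy]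
  · rw [h, Equiv.Perm.ofSubtype_apply_coe]

variable [DecidableEq Λ]

theorem permute_dotProduct (σ : Equiv.Perm Λ) (φ ψ : State Λ d) :
    permute σ φ ⬝ᵥ permute σ ψ = φ ⬝ᵥ ψ :=
  Equiv.sum_comp (σ.arrowCongr (Equiv.refl (Fin d))) fun n => φ n * ψ n

theorem permOp_mulVec (σ : Equiv.Perm Λ) (ψ : State Λ d) : permOp d σ *ᵥ ψ = permute σ ψ :=
  permMatrix_mulVec _

/-- The projector onto the states that are odd under the exchange of `x` and `y`; it is `0` if
`x = y`. -/
noncomputable def oddProj (d : ℕ) (x y : Λ) : Op Λ d :=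
  (2⁻¹ : ℂ) • (1 - permOp d (Equiv.swap x y))

theorem isStarProjection_oddProj (x y : Λ) : IsStarProjection (oddProj d x y) := by
  set S : Op Λ d := permOp d (Equiv.swap x y) with hS
  let τ : Equiv.Perm (Λ → Fin d) := (Equiv.swap x y).arrowCongr (Equiv.refl (Fin d))
  have involutive : τ * τ = 1 := by
    ext n z
    simp [τ, Equiv.arrowCongr]
  have sq : S * S = 1 := by
    rw [hS, permOp, ← permMatrix_mul τ τ, involutive, permMatrix_one]
  have selfAdj : Sᴴ = S := by
    rw [hS, permOp, conjTranspose_permMatrix τ, inv_eq_of_mul_eq_one_right involutive]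
  constructor
  · have : (1 - S) * (1 - S) = (2 : ℂ) • (1 - S) := by
      rw [sub_mul, mul_sub, mul_sub, sq, two_smul]
      simp only [one_mul, mul_one]
      abel
    rw [IsIdempotentElem, oddProj, smul_mul_smul_comm, this, smul_smul]
    norm_num [hS]
  · rw [IsSelfAdjoint, star_eq_conjTranspose, oddProj, conjTranspose_smul, conjTranspose_sub,
      selfAdj, conjTranspose_one, star_inv₀, star_ofNat]

theorem oddProj_comm (x y : Λ) : oddProj d x y = oddProj d y x := by
  rw [oddProj, oddProj, Equiv.swap_comm]

theorem oddProj_mulVec_eq_zero_iff {x y : Λ} {ψ : State Λ d} :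
    oddProj d x y *ᵥ ψ = 0 ↔ permute (Equiv.swap x y) ψ = ψ := by
  rw [oddProj, smul_mulVec, sub_mulVec, one_mulVec, permOp_mulVec,
    smul_eq_zero_iff_right (by norm_num), sub_eq_zero, eq_comm]

theorem embed_oddProj {X : Set Λ} [Fintype X] (x y : X) :
    embed X (oddProj d x y) = oddProj d (x : Λ) y := by
  classical
  rw [oddProj, oddProj, ← embedHom_apply, map_smul, map_sub, map_one, embedHom_apply, embed_permOp,
    Equiv.Perm.ofSubtype_swap_eq]

/-- `oddProj` as a function of unordered pairs of sites. -/
noncomputable def edgeProj (Λ : Type*) [Fintype Λ] [DecidableEq Λ] (d : ℕ) : Sym2 Λ → Op Λ d :=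
  Sym2.lift ⟨oddProj d, oddProj_comm⟩

theorem edgeProj_mem_localAlgebra (e : Sym2 Λ) : edgeProj Λ d e ∈ localAlgebra d {z | z ∈ e} := by
  classical
  induction e with | _ x y
  change oddProj d x y ∈ _
  rw [← embed_oddProj (X := {z | z ∈ s(x, y)}) ⟨x, Sym2.mem_mk_left x y⟩
    ⟨y, Sym2.mem_mk_right x y⟩]
  exact embed_mem_localAlgebra _

/-- The sum of all permutation operators; it is `N!` times the projector onto the
permutation-invariant states. -/
def symmetrizer (Λ : Type*) [Fintype Λ] [DecidableEq Λ] (d : ℕ) : Op Λ d :=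
  ∑ σ : Equiv.Perm Λ, permOp d σ

theorem symmetrizer_mulVec (ψ : State Λ d) :
    symmetrizer Λ d *ᵥ ψ = ∑ σ : Equiv.Perm Λ, permute σ ψ := by
  simp only [symmetrizer, sum_mulVec, permOp_mulVec]

theorem symmetrizer_mulVec_of_fixed {ψ : State Λ d} (hψ : ∀ σ : Equiv.Perm Λ, permute σ ψ = ψ) :
    symmetrizer Λ d *ᵥ ψ = (Fintype.card Λ).factorial • ψ := by
  simp only [symmetrizer_mulVec, hψ, sum_const, card_univ, Fintype.card_perm]

theorem permute_symmetrizer_mulVec (τ : Equiv.Perm Λ) (ψ : State Λ d) :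
    permute τ (symmetrizer Λ d *ᵥ ψ) = symmetrizer Λ d *ᵥ ψ := by
  rw [symmetrizer_mulVec, ← permOp_mulVec, mulVec_sum]
  simp only [permOp_mulVec, permute_permute]
  exact Equiv.sum_comp (Equiv.mulRight τ) fun σ => permute σ ψ

theorem mulVec_symmetrizer_mulVec_tensorVec_eq_zero {V : Submodule ℂ (Fin d → ℂ)} {O : Op Λ d}
    (hO : ∀ v ∈ V, O *ᵥ tensorVec Λ d (fun _ => v) = 0) {v : Λ → Fin d → ℂ} (hv : ∀ x, v x ∈ V) :
    O *ᵥ symmetrizer Λ d *ᵥ tensorVec Λ d v = 0 := by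
  rw [symmetrizer_mulVec, mulVec_sum]
  simp only [permute_tensorVec]
  exact sum_comp_perm_eq_zero_of_diagonal
    ((mulVecLin O).compMultilinearMap ((tensorVec Λ d).compLinearMap fun _ => V.subtype))
    (fun w => hO w w.2) fun x => ⟨v x, hv x⟩

end Permutation

namespace TargetSpace

section OneSite

variable {d r : ℕ} (T : TargetSpace d r)

/-- The coordinate vector of `|k⟩`. -/
def ketVec (k : Fin (r + 1)) : Fin d → ℂ := fun a => T.ket k a

/-- The coordinate vector of `⟨k|`. -/
def braVec (k : Fin (r + 1)) : Fin d → ℂ := star (T.ketVec k)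

/-- The target space in coordinates. -/
def vecSpace : Submodule ℂ (Fin d → ℂ) := Submodule.span ℂ (Set.range T.ketVec)

theorem ketVec_mem_vecSpace (k : Fin (r + 1)) : T.ketVec k ∈ T.vecSpace :=
  Submodule.subset_span (Set.mem_range_self k)

theorem ofLp_mem_vecSpace {v : EuclideanSpace ℂ (Fin d)} (hv : v ∈ T.space) :
    WithLp.ofLp v ∈ T.vecSpace := by
  have : T.vecSpace = T.space.map (WithLp.linearEquiv 2 ℂ (Fin d → ℂ)).toLinearMap := by
    rw [vecSpace, space, Submodule.map_span, ← Set.range_comp]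
    rfl
  rw [this]
  exact Submodule.mem_map_of_mem hv

theorem braVec_dotProduct_ketVec (j k : Fin (r + 1)) :
    T.braVec j ⬝ᵥ T.ketVec k = if j = k then 1 else 0 := by
  rw [dotProduct_comm]
  exact orthonormal_iff_ite.mp T.orthonormal j k

theorem dyad_eq_vecMulVec (k : Fin (r + 1)) :
    T.dyad k = vecMulVec (T.ketVec k) (T.braVec k) := rfl

theorem dyad_mulVec (k : Fin (r + 1)) (v : Fin d → ℂ) :
    T.dyad k *ᵥ v = (T.braVec k ⬝ᵥ v) • T.ketVec k := by
  rw [dyad_eq_vecMulVec, vecMulVec_mulVec, op_smul_eq_smul]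

theorem vecMul_dyad (k : Fin (r + 1)) (v : Fin d → ℂ) :
    v ᵥ* T.dyad k = (v ⬝ᵥ T.ketVec k) • T.braVec k := by
  rw [dyad_eq_vecMulVec, vecMul_vecMulVec]

theorem dyad_mul_dyad (j k : Fin (r + 1)) :
    T.dyad j * T.dyad k = if j = k then T.dyad k else 0 := by
  rw [dyad_eq_vecMulVec, dyad_eq_vecMulVec, vecMulVec_mul_vecMulVec, braVec_dotProduct_ketVec]
  split_ifs with h <;> simp [h]

theorem dyad_conjTranspose (k : Fin (r + 1)) : (T.dyad k)ᴴ = T.dyad k := by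
  rw [dyad_eq_vecMulVec, conjTranspose_vecMulVec, braVec, star_star]

theorem isStarProjection_proj : IsStarProjection T.proj := by
  constructor
  · simp [IsIdempotentElem, proj, sum_mul, mul_sum, dyad_mul_dyad]
  · rw [IsSelfAdjoint, star_eq_conjTranspose, proj, conjTranspose_sum]
    simp only [dyad_conjTranspose]

theorem proj_mulVec (v : Fin d → ℂ) : T.proj *ᵥ v = ∑ k, (T.braVec k ⬝ᵥ v) • T.ketVec k := by
  simp only [proj, sum_mulVec, dyad_mulVec]

theorem proj_mulVec_of_mem {v : Fin d → ℂ} (hv : v ∈ T.vecSpace) : T.proj *ᵥ v = v := by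
  suffices T.vecSpace ≤ LinearMap.eqLocus T.proj.mulVecLin LinearMap.id from this hv
  rw [vecSpace, Submodule.span_le]
  rintro _ ⟨k, rfl⟩
  simp [proj_mulVec, braVec_dotProduct_ketVec]

theorem braVec_vecMul_proj (k : Fin (r + 1)) : T.braVec k ᵥ* T.proj = T.braVec k := by
  simp [proj, vecMul_sum, vecMul_dyad, braVec_dotProduct_ketVec]

theorem cartan_conjTranspose (i : Fin r) : (T.cartan i)ᴴ = T.cartan i := by
  simp [cartan, conjTranspose_sum, dyad_conjTranspose]

theorem cartan_mulVec_ketVec (i : Fin r) (k : Fin (r + 1)) :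
    T.cartan i *ᵥ T.ketVec k = (T.weight k i : ℂ) • T.ketVec k := by
  simp [cartan, sum_mulVec, smul_mulVec, dyad_mulVec, braVec_dotProduct_ketVec]

theorem braVec_vecMul_cartan (i : Fin r) (k : Fin (r + 1)) :
    T.braVec k ᵥ* T.cartan i = (T.weight k i : ℂ) • T.braVec k := by
  simp [cartan, vecMul_sum, vecMul_smul, vecMul_dyad, braVec_dotProduct_ketVec]

/-- The functions `1, m^1, …, m^r` of the on-site basis state. -/
def affineWeight : Fin (r + 1) → Fin (r + 1) → ℂ :=
  Fin.cons 1 fun i k => T.weight k i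

theorem linearIndependent_affineWeight : LinearIndependent ℂ T.affineWeight := by
  have weight_indep : LinearIndependent ℂ fun (i : Fin r) (k : Fin (r + 1)) => (T.weight k i : ℂ) :=
    (linearIndependent_algebraMap_comp_iff (R := ℝ) (S := ℂ)).mpr T.weight_indep
  refine linearIndependent_finCons.mpr ⟨weight_indep, fun one_mem => ?_⟩
  obtain ⟨t, ht⟩ := (Submodule.mem_span_range_iff_exists_fun ℂ).mp one_mem
  have sum_weight (i : Fin r) : ∑ k, (T.weight k i : ℂ) = 0 := by
    exact_mod_cast T.weight_sum i
  have : ∑ k : Fin (r + 1), (∑ i, t i • fun k => (T.weight k i : ℂ)) k = 0 := by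
    simp only [Finset.sum_apply, Pi.smul_apply, smul_eq_mul]
    rw [sum_comm]
    simp only [← mul_sum, sum_weight, mul_zero, sum_const_zero]
  rw [ht] at this
  exact (Nat.cast_add_one_ne_zero r : (r : ℂ) + 1 ≠ 0) (by simpa using this)

theorem exists_affine (g : Fin (r + 1) → ℂ) :
    ∃ (b : Fin r → ℂ) (c : ℂ), ∀ k, g k = ∑ i, b i * (T.weight k i : ℂ) + c := by
  have g_mem : g ∈ Submodule.span ℂ (Set.range T.affineWeight) := by
    rw [T.linearIndependent_affineWeight.span_eq_top_of_card_eq_finrank' (by simp)]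
    trivial
  obtain ⟨t, rfl⟩ := (Submodule.mem_span_range_iff_exists_fun ℂ).mp g_mem
  exact ⟨fun i => t i.succ, t 0, fun k => by simp [affineWeight, Fin.sum_univ_succ, add_comm]⟩

theorem affine_eq_zero {b : Fin r → ℂ} {c : ℂ}
    (h : ∀ k, ∑ i, b i * (T.weight k i : ℂ) + c = 0) : b = 0 ∧ c = 0 := by
  have coeff := Fintype.linearIndependent_iff.mp T.linearIndependent_affineWeight (Fin.cons c b) <|
    funext fun k => by simpa [affineWeight, Fin.sum_univ_succ, add_comm] using h k
  exact ⟨funext fun i => coeff i.succ, coeff 0⟩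

end OneSite

section Leak

variable {d r : ℕ} (T : TargetSpace d r) {Λ : Type*} [Fintype Λ] [DecidableEq Λ]

/-- The projector onto the states that leave the target space at site `x`. -/
def leakProj (x : Λ) : Op Λ d := siteOp x (1 - T.proj)

theorem isStarProjection_leakProj (x : Λ) : IsStarProjection (T.leakProj x) :=
  T.isStarProjection_proj.one_sub.map (siteOpHom Λ d x)

theorem leakProj_mulVec_tensorVec {v : Λ → Fin d → ℂ} {x : Λ} (hv : v x ∈ T.vecSpace) :
    T.leakProj x *ᵥ tensorVec Λ d v = 0 := by
  rw [leakProj, siteOp_mulVec, sub_mulVec, one_mulVec, T.proj_mulVec_of_mem hv, sub_self]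
  exact (tensorVec Λ d).map_update_zero v x

/-- The projector onto the states that, among the sites of `X ∪ Y`, leave the target space exactly
at the sites of `Y`; for `Y ⊆ X` these projectors resolve the identity. -/
def leakSector (X Y : Finset Λ) : Op Λ d :=
  productOp (Y.piecewise (fun _ => 1 - T.proj) (X.piecewise (fun _ => T.proj) fun _ => 1))

theorem leakSector_empty (X : Finset Λ) : T.leakSector X ∅ = T.projOn X := by
  rw [leakSector, piecewise_empty, projOn]
  rfl

theorem sum_leakSector (X : Finset Λ) : ∑ Y ∈ X.powerset, T.leakSector X Y = 1 := by
  simp only [leakSector, ← productOpMultilinear_apply]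
  rw [← (productOpMultilinear Λ d).map_piecewise_add, productOpMultilinear_apply, ← productOp_one]
  congr 1
  ext1 x
  by_cases hx : x ∈ X <;> simp [hx]

theorem leakSector_mul_leakProj (X : Finset Λ) {Y : Finset Λ} {y : Λ} (hy : y ∈ Y) :
    T.leakSector X Y * T.leakProj y = T.leakSector X Y := by
  rw [leakSector, leakProj, siteOp, productOp_mul]
  congr 1
  ext1 x
  obtain rfl | hx := eq_or_ne x y
  · rw [piecewise_eq_of_mem _ _ _ hy, update_self]
    exact T.isStarProjection_proj.one_sub.isIdempotentElem
  · rw [update_of_ne hx, mul_one]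

theorem leakSector_mul_projOn_compl {X Y : Finset Λ} (hYX : Y ⊆ X) :
    T.leakSector X Y * T.projOn Xᶜ = T.leakSector univ Y := by
  rw [leakSector, projOn, leakSector, productOp_mul]
  congr 1
  ext1 x
  by_cases hY : x ∈ Y
  · simp [hY, hYX hY]
  · by_cases hX : x ∈ X <;> simp [hY, hX]

theorem leakSector_mem_localAlgebra {X Y : Finset Λ} (hYX : Y ⊆ X) :
    T.leakSector X Y ∈ localAlgebra d (X : Set Λ) := by
  refine productOp_mem_localAlgebra fun x hx => ?_
  have hx : x ∉ X := hx
  rw [piecewise_eq_of_notMem _ _ _ fun hY => hx (hYX hY), piecewise_eq_of_notMem _ _ _ hx]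

theorem projOn_mem_localAlgebra (X : Finset Λ) : T.projOn X ∈ localAlgebra d (X : Set Λ) :=
  productOp_mem_localAlgebra fun _ hx => if_neg hx

theorem projOn_mulVec_tensorVec (X : Finset Λ) {v : Λ → Fin d → ℂ} (hv : ∀ x, v x ∈ T.vecSpace) :
    T.projOn X *ᵥ tensorVec Λ d v = tensorVec Λ d v := by
  rw [projOn, productOp_mulVec]
  congr 1
  ext1 x
  split_ifs
  exacts [T.proj_mulVec_of_mem (hv x), one_mulVec _]

theorem projOn_univ_mulVec_of_leakProj_mulVec_eq_zero {φ : State Λ d}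
    (hφ : ∀ x, T.leakProj x *ᵥ φ = 0) : T.projOn univ *ᵥ φ = φ := by
  conv_rhs => rw [← one_mulVec φ, ← T.sum_leakSector univ, sum_mulVec]
  rw [sum_eq_single_of_mem ∅ (empty_mem_powerset univ), leakSector_empty]
  intro Y _ hY
  obtain ⟨y, hy⟩ := nonempty_iff_ne_empty.mpr hY
  rw [← T.leakSector_mul_leakProj univ hy, ← mulVec_mulVec, hφ, mulVec_zero]

end Leak

section ScarSpace

variable {d r : ℕ} (T : TargetSpace d r) {Λ : Type*} [Fintype Λ] [DecidableEq Λ]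

/-- The product basis state `⨂_x |n_x⟩`. -/
def ketConf (n : Λ → Fin (r + 1)) : State Λ d := tensorVec Λ d fun x => T.ketVec (n x)

/-- The coordinate vector of the functional `⨂_x ⟨n_x|`. -/
def braConf (n : Λ → Fin (r + 1)) : State Λ d := tensorVec Λ d fun x => T.braVec (n x)

theorem projOn_univ_mulVec (φ : State Λ d) :
    T.projOn univ *ᵥ φ = ∑ n : Λ → Fin (r + 1), (T.braConf n ⬝ᵥ φ) • T.ketConf n := by
  have expand : T.projOn univ = ∑ n : Λ → Fin (r + 1), productOp fun x => T.dyad (n x) := by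
    simp only [projOn, mem_univ, if_true, proj]
    exact (productOpMultilinear Λ d).map_sum fun _ => T.dyad
  have dyadConf (n : Λ → Fin (r + 1)) :
      productOp (fun x => T.dyad (n x)) = vecMulVec (T.ketConf n) (T.braConf n) := by
    ext m m'
    simp only [dyad_eq_vecMulVec, productOp_apply, vecMulVec_apply, prod_mul_distrib, ketConf,
      braConf, tensorVec_apply]
  simp only [expand, dyadConf, sum_mulVec, vecMulVec_mulVec, op_smul_eq_smul]

theorem weightState_eq_symmetrizer_mulVec (k : Λ → Fin (r + 1)) :
    T.weightState k = symmetrizer Λ d *ᵥ T.ketConf k :=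
  (symmetrizer_mulVec _).symm

theorem weightState_eq_sum_ketConf (k : Λ → Fin (r + 1)) :
    T.weightState k = ∑ σ : Equiv.Perm Λ, T.ketConf (k ∘ σ) := by
  rw [weightState_eq_symmetrizer_mulVec, symmetrizer_mulVec]
  exact sum_congr rfl fun σ _ => permute_tensorVec σ _

theorem leakProj_mulVec_eq_zero_of_mem_symSpace (x : Λ) {ψ : State Λ d}
    (hψ : ψ ∈ T.symSpace Λ) : T.leakProj x *ᵥ ψ = 0 := by
  suffices Submodule.span ℂ {φ | ∃ v : Λ → EuclideanSpace ℂ (Fin d),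
      (∀ x, v x ∈ T.space) ∧ φ = productState v} ≤ LinearMap.ker (T.leakProj x).mulVecLin from
    this hψ.1
  rw [Submodule.span_le]
  rintro _ ⟨v, hv, rfl⟩
  exact T.leakProj_mulVec_tensorVec (v := fun x => WithLp.ofLp (v x)) (T.ofLp_mem_vecSpace (hv x))

theorem isLocalAnnihilatingProjector_leakProj (x : Λ) :
    T.IsLocalAnnihilatingProjector {x} (T.leakProj x) :=
  ⟨T.isStarProjection_leakProj x, siteOp_mem_localAlgebra x _, fun _ =>
    T.leakProj_mulVec_eq_zero_of_mem_symSpace x⟩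

theorem isLocalAnnihilatingProjector_edgeProj (e : Sym2 Λ) :
    T.IsLocalAnnihilatingProjector {z | z ∈ e} (edgeProj Λ d e) := by
  refine ⟨?_, edgeProj_mem_localAlgebra e, fun ψ hψ => ?_⟩ <;> induction e with | _ x y
  · exact isStarProjection_oddProj x y
  · exact oddProj_mulVec_eq_zero_iff.mpr (hψ.2 _)

/-- The span of the scar states `ψ_k`. It is the space `Sym^N(𝔥ˢ)`. -/
def scarSpace (Λ : Type*) [Fintype Λ] [DecidableEq Λ] : Submodule ℂ (State Λ d) :=
  Submodule.span ℂ (Set.range T.weightState)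

theorem weightState_mem_scarSpace (k : Λ → Fin (r + 1)) : T.weightState k ∈ T.scarSpace Λ :=
  Submodule.subset_span (Set.mem_range_self k)

theorem scarSpace_le_iff {W : Submodule ℂ (State Λ d)} :
    T.scarSpace Λ ≤ W ↔ ∀ k, T.weightState k ∈ W :=
  Submodule.span_le.trans Set.range_subset_iff

theorem mem_scarSpace_iff {φ : State Λ d} :
    φ ∈ T.scarSpace Λ ↔
      (∀ x, T.leakProj x *ᵥ φ = 0) ∧ ∀ σ : Equiv.Perm Λ, permute σ φ = φ := by
  refine ⟨fun hφ => ⟨fun x => ?_, fun σ => ?_⟩, fun ⟨hleak, hperm⟩ => ?_⟩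
  · suffices T.scarSpace Λ ≤ LinearMap.ker (T.leakProj x).mulVecLin from this hφ
    refine T.scarSpace_le_iff.mpr fun k => ?_
    rw [LinearMap.mem_ker, mulVecLin_apply, weightState_eq_sum_ketConf, mulVec_sum]
    exact sum_eq_zero fun τ _ => T.leakProj_mulVec_tensorVec (T.ketVec_mem_vecSpace _)
  · suffices T.scarSpace Λ ≤ LinearMap.eqLocus (permOp d σ).mulVecLin LinearMap.id by
      simpa [permOp_mulVec] using this hφ
    refine T.scarSpace_le_iff.mpr fun k => ?_
    rw [LinearMap.mem_eqLocus, mulVecLin_apply, permOp_mulVec,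
      weightState_eq_symmetrizer_mulVec, permute_symmetrizer_mulVec, LinearMap.id_apply]
  · have hfact : ((Fintype.card Λ).factorial : ℂ) ≠ 0 := by exact_mod_cast Nat.factorial_ne_zero _
    rw [← Submodule.smul_mem_iff _ hfact, Nat.cast_smul_eq_nsmul,
      ← symmetrizer_mulVec_of_fixed hperm,
      ← T.projOn_univ_mulVec_of_leakProj_mulVec_eq_zero hleak, projOn_univ_mulVec, mulVec_sum]
    refine sum_mem fun n _ => ?_
    rw [mulVec_smul, ← weightState_eq_symmetrizer_mulVec]
    exact Submodule.smul_mem _ _ (T.weightState_mem_scarSpace n)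

theorem mem_symSpace_of_mem_scarSpace {ψ : State Λ d} (hψ : ψ ∈ T.scarSpace Λ) :
    ψ ∈ T.symSpace Λ := by
  refine ⟨?_, (T.mem_scarSpace_iff.mp hψ).2⟩
  suffices T.scarSpace Λ ≤ _ from this hψ
  refine T.scarSpace_le_iff.mpr fun k => ?_
  rw [weightState_eq_sum_ketConf]
  exact sum_mem fun σ _ => Submodule.subset_span
    ⟨fun x => T.ket (k (σ x)), fun x => Submodule.subset_span (Set.mem_range_self _), rfl⟩

theorem coherent_mem_scarSpace {v : Fin d → ℂ} (hv : v ∈ T.vecSpace) :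
    tensorVec Λ d (fun _ => v) ∈ T.scarSpace Λ :=
  T.mem_scarSpace_iff.mpr ⟨fun _ => T.leakProj_mulVec_tensorVec hv, fun σ => permute_tensorVec σ _⟩

theorem mulVec_mem_scarSpace {H : Op Λ d}
    (heig : ∀ k, ∃ E : ℂ, H *ᵥ T.weightState k = E • T.weightState k) {ψ : State Λ d}
    (hψ : ψ ∈ T.scarSpace Λ) : H *ᵥ ψ ∈ T.scarSpace Λ := by
  suffices T.scarSpace Λ ≤ (T.scarSpace Λ).comap H.mulVecLin from this hψ
  refine T.scarSpace_le_iff.mpr fun k => ?_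
  obtain ⟨E, hE⟩ := heig k
  rw [Submodule.mem_comap, mulVecLin_apply, hE]
  exact Submodule.smul_mem _ _ (T.weightState_mem_scarSpace k)

/-- The left ideal of the operators that annihilate all coherent states `⨂_x v`, `v ∈ 𝔥ˢ`. -/
def coherentAnnihilator (Λ : Type*) [Fintype Λ] [DecidableEq Λ] : Ideal (Op Λ d) where
  carrier := {O | ∀ v ∈ T.vecSpace, O *ᵥ tensorVec Λ d (fun _ => v) = 0}
  zero_mem' _ _ := zero_mulVec _
  add_mem' hO hO' v hv := by rw [add_mulVec, hO v hv, hO' v hv, add_zero]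
  smul_mem' A O hO v hv := by rw [smul_eq_mul, ← mulVec_mulVec, hO v hv, mulVec_zero]

theorem mem_coherentAnnihilator {O : Op Λ d} :
    O ∈ T.coherentAnnihilator Λ ↔ ∀ v ∈ T.vecSpace, O *ᵥ tensorVec Λ d (fun _ => v) = 0 := Iff.rfl

theorem mulVec_eq_zero_of_mem_scarSpace {O : Op Λ d} (hO : O ∈ T.coherentAnnihilator Λ)
    {ψ : State Λ d} (hψ : ψ ∈ T.scarSpace Λ) : O *ᵥ ψ = 0 := by
  suffices T.scarSpace Λ ≤ LinearMap.ker O.mulVecLin from this hψ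
  refine T.scarSpace_le_iff.mpr fun k => ?_
  rw [LinearMap.mem_ker, mulVecLin_apply, weightState_eq_symmetrizer_mulVec]
  exact mulVec_symmetrizer_mulVec_tensorVec_eq_zero hO fun x => T.ketVec_mem_vecSpace (k x)

theorem mem_span_leakProj_edgeProj_of_preconnected {G : SimpleGraph Λ} (hG : G.Preconnected)
    {O : Op Λ d} (hO : O ∈ T.coherentAnnihilator Λ) :
    O ∈ Ideal.span (Set.range T.leakProj ∪ edgeProj Λ d '' G.edgeSet) := by
  refine mem_leftIdeal_span_of_common_kernel fun φ hφ => ?_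
  have fixed : fixingPerms φ = ⊤ := fixingPerms_eq_top_of_preconnected hG fun x y hxy =>
    oddProj_mulVec_eq_zero_iff.mp (hφ _ (.inr ⟨s(x, y), hxy, rfl⟩))
  exact T.mulVec_eq_zero_of_mem_scarSpace hO <| T.mem_scarSpace_iff.mpr
    ⟨fun x => hφ _ (.inl ⟨x, rfl⟩), fun σ => mem_fixingPerms.mp (fixed ▸ Subgroup.mem_top σ)⟩

end ScarSpace

end TargetSpace

section Decomposable

variable {Λ : Type*} [Fintype Λ] [DecidableEq Λ] {d r : ℕ}

/-- The multiples `O P` of `P` with a coefficient `O` that acts non-trivially only on `X`. -/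
noncomputable def localMultiples (X : Set Λ) (P : Op Λ d) : Submodule ℂ (Op Λ d) :=
  (localAlgebra d X).toSubmodule.map (LinearMap.mulRight ℂ P)

theorem mul_mem_localMultiples {X : Set Λ} {O P : Op Λ d} (hO : O ∈ localAlgebra d X) :
    O * P ∈ localMultiples X P := ⟨O, hO, rfl⟩

theorem exists_eq_sum_mul_of_mem_iSup_localMultiples {ι : Type*} {s : Finset ι} {X : ι → Set Λ}
    {P : ι → Op Λ d} {O : Op Λ d} (hO : O ∈ ⨆ i ∈ s, localMultiples (X i) (P i)) :
    ∃ h : ι → Op Λ d, O = ∑ i ∈ s, h i * P i ∧ ∀ i, h i ∈ localAlgebra d (X i) := by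
  obtain ⟨M, rfl⟩ := (Submodule.mem_iSup_finset_iff_exists_sum _ _).mp hO
  choose h hX hP using fun i => (M i).2
  exact ⟨h, sum_congr rfl fun i _ => (hP i).symm, hX⟩

namespace TargetSpace

variable (T : TargetSpace d r) (G : SimpleGraph Λ) (U : Λ → Set Λ)

/-- The operators `∑_x h_x P_x + ∑_e h_e P_e` with `P_x` the projector onto the states that leave
the target space at the site `x`, `P_e` the projector onto the states that are odd under the
exchange of the ends of the edge `e`, `h_x` acting on `U x`, and `h_e` acting on the intersection
of the `U x` over the ends `x` of `e`. -/
noncomputable def decomposable : Submodule ℂ (Op Λ d) :=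
  (⨆ x, localMultiples (U x) (T.leakProj x)) ⊔
    ⨆ e ∈ G.edgeSet, localMultiples {z | ∀ x ∈ e, z ∈ U x} (edgeProj Λ d e)

variable {T G U}

theorem mul_leakProj_mem_decomposable {x : Λ} {O : Op Λ d} (hO : O ∈ localAlgebra d (U x)) :
    O * T.leakProj x ∈ T.decomposable G U :=
  Submodule.mem_sup_left (Submodule.mem_iSup_of_mem x (mul_mem_localMultiples hO))

theorem mul_edgeProj_mem_decomposable {e : Sym2 Λ} (he : e ∈ G.edgeSet) {O : Op Λ d}
    (hO : O ∈ localAlgebra d {z | ∀ x ∈ e, z ∈ U x}) :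
    O * edgeProj Λ d e ∈ T.decomposable G U :=
  Submodule.mem_sup_right <| Submodule.mem_iSup_of_mem e <|
    Submodule.mem_iSup_of_mem he (mul_mem_localMultiples hO)

theorem exists_eq_sum_of_mem_decomposable [Fintype G.edgeSet] {O : Op Λ d}
    (hO : O ∈ T.decomposable G U) :
    ∃ (h₁ : Λ → Op Λ d) (h₂ : Sym2 Λ → Op Λ d),
      O = ∑ x, h₁ x * T.leakProj x + ∑ e ∈ G.edgeFinset, h₂ e * edgeProj Λ d e ∧
      (∀ x, h₁ x ∈ localAlgebra d (U x)) ∧ ∀ e, h₂ e ∈ localAlgebra d {z | ∀ x ∈ e, z ∈ U x} := by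
  obtain ⟨O₁, hO₁, O₂, hO₂, rfl⟩ := Submodule.mem_sup.mp hO
  simp only [← SimpleGraph.mem_edgeFinset] at hO₂
  obtain ⟨h₁, rfl, hU₁⟩ :=
    exists_eq_sum_mul_of_mem_iSup_localMultiples (s := univ) (by simpa using hO₁)
  obtain ⟨h₂, rfl, hU₂⟩ := exists_eq_sum_mul_of_mem_iSup_localMultiples hO₂
  exact ⟨h₁, h₂, rfl, hU₁, hU₂⟩

theorem mulVec_eq_zero_of_mem_decomposable {O : Op Λ d} (hO : O ∈ T.decomposable G U)
    {ψ : State Λ d} (hψ : ψ ∈ T.symSpace Λ) : O *ᵥ ψ = 0 := by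
  classical
  obtain ⟨h₁, h₂, rfl, -⟩ := exists_eq_sum_of_mem_decomposable hO
  simp only [add_mulVec, sum_mulVec, ← mulVec_mulVec,
    (T.isLocalAnnihilatingProjector_leakProj _).2.2 ψ hψ,
    (T.isLocalAnnihilatingProjector_edgeProj _).2.2 ψ hψ, mulVec_zero, sum_const_zero, add_zero]

theorem mem_coherentAnnihilator_of_embed {V : Set Λ} [Fintype V] [Nonempty V] {A : Op V d}
    (hA : embed V A ∈ T.coherentAnnihilator Λ) : A ∈ T.coherentAnnihilator V := by
  classical
  intro v hv
  rcases eq_or_ne v 0 with rfl | hv0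
  · rw [show tensorVec V d (fun _ => 0) = 0 from (tensorVec V d).map_zero, mulVec_zero]
  obtain ⟨a, ha⟩ := Function.ne_iff.mp hv0
  ext n
  have := congr_fun (hA v hv) ((splitConf d V).symm (n, fun _ => a))
  rw [embed_mulVec_tensorVec, Equiv.apply_symm_apply] at this
  exact (mul_eq_zero.mp this).resolve_right (prod_ne_zero_iff.mpr fun _ _ => ha)

theorem mem_decomposable_of_connected {V : Set Λ} (hV : (G.induce V).Connected)
    (hVU : ∀ x ∈ V, V ⊆ U x) {O : Op Λ d} (hO : O ∈ localAlgebra d V)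
    (hann : O ∈ T.coherentAnnihilator Λ) : O ∈ T.decomposable G U := by
  classical
  obtain ⟨A, rfl⟩ := hO
  have := hV.nonempty
  have A_mem := T.mem_span_leakProj_edgeProj_of_preconnected hV.preconnected
    (mem_coherentAnnihilator_of_embed hann)
  clear hann
  induction A_mem using Submodule.closure_induction with
  | zero => rw [← embedHom_apply, map_zero]; exact zero_mem _
  | add A B _ _ hA hB => rw [← embedHom_apply, map_add]; exact add_mem hA hB
  | smul_mem B P hP =>
    rw [smul_eq_mul, embed_mul]
    rcases hP with ⟨x, rfl⟩ | ⟨e, he, rfl⟩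
    · rw [leakProj, embed_siteOp]
      exact mul_leakProj_mem_decomposable
        (localAlgebra_mono (hVU x x.2) (embed_mem_localAlgebra B))
    · induction e with | _ x y
      rw [edgeProj, Sym2.lift_mk, embed_oddProj]
      have hxy : G.Adj x y := he
      have hVU' : V ⊆ {z | ∀ w ∈ s((x : Λ), (y : Λ)), z ∈ U w} := fun z hz w hw => by
        rcases Sym2.mem_iff.mp hw with rfl | rfl
        exacts [hVU x x.2 hz, hVU y y.2 hz]
      exact mul_edgeProj_mem_decomposable hxy
        (localAlgebra_mono hVU' (embed_mem_localAlgebra B))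

end TargetSpace

end Decomposable

namespace TargetSpace

section LeakStep

variable {Λ : Type*} [Fintype Λ] [DecidableEq Λ] {d r : ℕ} (T : TargetSpace d r)

theorem leakSector_univ_mulVec_of_subset {X Y : Finset Λ} (hYX : Y ⊆ X) {O : Op Λ d}
    (hO : O ∈ localAlgebra d (X : Set Λ)) {v : Λ → Fin d → ℂ} (hv : ∀ x, v x ∈ T.vecSpace) :
    T.leakSector univ Y *ᵥ (O *ᵥ tensorVec Λ d v) = T.leakSector X Y *ᵥ (O *ᵥ tensorVec Λ d v) := by
  have comm : Commute (T.projOn Xᶜ) O := commute_of_disjoint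
    (by rw [coe_compl]; exact disjoint_compl_left) (T.projOn_mem_localAlgebra Xᶜ) hO
  rw [← leakSector_mul_projOn_compl T hYX, mulVec_mulVec, mul_assoc, comm.eq, ← mul_assoc,
    ← mulVec_mulVec, T.projOn_mulVec_tensorVec _ hv, mulVec_mulVec]

theorem leakSector_univ_mulVec_of_not_subset {X Y : Finset Λ} (hYX : ¬ Y ⊆ X) {O : Op Λ d}
    (hO : O ∈ localAlgebra d (X : Set Λ)) {v : Λ → Fin d → ℂ} (hv : ∀ x, v x ∈ T.vecSpace) :
    T.leakSector univ Y *ᵥ (O *ᵥ tensorVec Λ d v) = 0 := by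
  obtain ⟨y, hyY, hyX⟩ := not_subset.mp hYX
  have comm : Commute (T.leakProj y) O := commute_of_disjoint
    (Set.disjoint_singleton_left.mpr hyX) (siteOp_mem_localAlgebra y _) hO
  rw [← leakSector_mul_leakProj T univ hyY, mulVec_mulVec, mul_assoc, comm.eq,
    ← mulVec_mulVec, ← mulVec_mulVec, T.leakProj_mulVec_tensorVec (hv y), mulVec_zero, mulVec_zero]

/-- The part of the Hamiltonian `∑_X h_X` that moves the sites of `Y`, and no other sites of the
region of the respective term, out of the target space. -/
def leakPart (h : Finset Λ → Op Λ d) (Y : Finset Λ) : Op Λ d :=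
  ∑ X with Y ⊆ X, T.leakSector X Y * h X

variable {T} {G : SimpleGraph Λ} {h : Finset Λ → Op Λ d}

theorem leakPart_mem_coherentAnnihilator (hh : ∀ X : Finset Λ, h X ∈ localAlgebra d (X : Set Λ))
    (hscar : ∀ ψ ∈ T.scarSpace Λ, (∑ X, h X) *ᵥ ψ ∈ T.scarSpace Λ) {Y : Finset Λ}
    (hY : Y.Nonempty) : T.leakPart h Y ∈ T.coherentAnnihilator Λ := by
  refine T.mem_coherentAnnihilator.mpr fun v hv => ?_
  obtain ⟨y, hy⟩ := hY
  have leak : T.leakProj y *ᵥ ((∑ X, h X) *ᵥ tensorVec Λ d fun _ => v) = 0 :=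
    (T.mem_scarSpace_iff.mp (hscar _ (T.coherent_mem_scarSpace hv))).1 y
  calc T.leakPart h Y *ᵥ tensorVec Λ d (fun _ => v)
      = ∑ X with Y ⊆ X, T.leakSector univ Y *ᵥ (h X *ᵥ tensorVec Λ d fun _ => v) := by
        rw [leakPart, sum_mulVec]
        refine sum_congr rfl fun X hX => ?_
        rw [T.leakSector_univ_mulVec_of_subset (mem_filter.mp hX).2 (hh X) fun _ => hv,
          mulVec_mulVec]
    _ = ∑ X, T.leakSector univ Y *ᵥ (h X *ᵥ tensorVec Λ d fun _ => v) :=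
        sum_subset (filter_subset _ _) fun X _ hX =>
          T.leakSector_univ_mulVec_of_not_subset (by simpa using hX) (hh X) fun _ => hv
    _ = 0 := by
        rw [← mulVec_sum, ← sum_mulVec, ← T.leakSector_mul_leakProj univ hy, ← mulVec_mulVec, leak,
          mulVec_zero]

theorem leakPart_mem_decomposable (hloc : IsLocal G h)
    (hscar : ∀ ψ ∈ T.scarSpace Λ, (∑ X, h X) *ᵥ ψ ∈ T.scarSpace Λ) {Y : Finset Λ}
    (hY : Y.Nonempty) : T.leakPart h Y ∈ T.decomposable G (interactionHull h) := by
  let regions : Set (Set Λ) := {V | ∃ X : Finset Λ, ↑X = V ∧ h X ≠ 0 ∧ Y ⊆ X}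
  have leakPart_mem : T.leakPart h Y ∈ localAlgebra d (⋃₀ regions) := by
    refine sum_mem fun X hX => ?_
    obtain ⟨-, hYX⟩ := mem_filter.mp hX
    obtain h0 | h0 := eq_or_ne (h X) 0
    · rw [h0, mul_zero]
      exact zero_mem _
    · have hX : (X : Set Λ) ∈ regions := ⟨X, rfl, h0, hYX⟩
      exact localAlgebra_mono (Set.subset_sUnion_of_mem hX)
        (mul_mem (T.leakSector_mem_localAlgebra hYX) (hloc.supported X))
  obtain hempty | hne := regions.eq_empty_or_nonempty
  · suffices T.leakPart h Y = 0 from this ▸ zero_mem _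
    refine sum_eq_zero fun X hX => ?_
    by_contra h0
    have : (X : Set Λ) ∈ regions := ⟨X, rfl, right_ne_zero_of_mul h0, (mem_filter.mp hX).2⟩
    simp [hempty] at this
  obtain ⟨y, hy⟩ := hY
  have connected : (G.induce (⋃₀ regions)).Connected := by
    refine SimpleGraph.induce_sUnion_connected_of_pairwise_not_disjoint hne ?_ ?_
    · rintro _ _ ⟨X, rfl, -, hX⟩ ⟨X', rfl, -, hX'⟩
      exact ⟨y, hX hy, hX' hy⟩
    · rintro _ ⟨X, rfl, h0, -⟩
      exact hloc.connected X h0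
  refine mem_decomposable_of_connected connected ?_ leakPart_mem
    (leakPart_mem_coherentAnnihilator hloc.supported hscar ⟨y, hy⟩)
  rintro x ⟨_, ⟨X, rfl, hX0, hX⟩, hx⟩ z ⟨_, ⟨Z, rfl, hZ0, hZ⟩, hz⟩
  exact ⟨X, Z, hX0, hZ0, hx, hz, y, hX hy, hZ hy⟩

theorem sum_sub_sum_projOn_mul_mem_decomposable (hloc : IsLocal G h)
    (hscar : ∀ ψ ∈ T.scarSpace Λ, (∑ X, h X) *ᵥ ψ ∈ T.scarSpace Λ) :
    ∑ X, h X - ∑ X, T.projOn X * h X ∈ T.decomposable G (interactionHull h) := by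
  have resolve : ∑ X, h X = ∑ Y, T.leakPart h Y := by
    calc ∑ X, h X = ∑ X, ∑ Y with Y ⊆ X, T.leakSector X Y * h X := by
          refine sum_congr rfl fun X _ => ?_
          rw [← sum_mul, filter_subset_univ, sum_leakSector, one_mul]
      _ = ∑ Y, T.leakPart h Y := sum_comm' (by simp)
  have noLeak : ∑ X, T.projOn X * h X = T.leakPart h ∅ := by
    simp only [leakPart, empty_subset, filter_true, leakSector_empty]
  rw [resolve, noLeak, ← sum_erase_eq_sub (mem_univ ∅)]
  exact sum_mem fun Y hY =>
    leakPart_mem_decomposable hloc hscar (nonempty_iff_ne_empty.mpr (ne_of_mem_erase hY))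

end LeakStep

section Diagonal

variable {d r : ℕ} (T : TargetSpace d r) {Λ : Type*} [Fintype Λ]

/-- A resolution of the identity on one site that refines the decomposition into the states
`ket k`; the orthogonal complement of the target space is assigned to the label `0`. -/
def level (k : Fin (r + 1)) : Matrix (Fin d) (Fin d) ℂ :=
  T.dyad k + if k = 0 then 1 - T.proj else 0

theorem sum_smul_level (g : Fin (r + 1) → ℂ) :
    ∑ k, g k • T.level k = ∑ k, g k • T.dyad k + g 0 • (1 - T.proj) := by
  simp [level, sum_add_distrib]

theorem sum_level : ∑ k, T.level k = 1 := by
  have := T.sum_smul_level 1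
  simp only [Pi.one_apply, one_smul] at this
  rw [this, ← proj, add_sub_cancel]

theorem level_mulVec {v : Fin d → ℂ} (hv : v ∈ T.vecSpace) (k : Fin (r + 1)) :
    T.level k *ᵥ v = (T.braVec k ⬝ᵥ v) • T.ketVec k := by
  have leak : (1 - T.proj) *ᵥ v = 0 := by
    rw [sub_mulVec, one_mulVec, T.proj_mulVec_of_mem hv, sub_self]
  rw [level, add_mulVec, dyad_mulVec]
  split_ifs
  exacts [by rw [leak, add_zero], by rw [zero_mulVec, add_zero]]

theorem sum_affine_eq (b : Fin r → ℂ) (c : ℂ) (n : Λ → Fin (r + 1)) :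
    ∑ x, (∑ i, b i * (T.weight (n x) i : ℂ) + c) =
      ∑ i, b i * (T.totalWeight n i : ℂ) + Fintype.card Λ * c := by
  simp only [sum_add_distrib, sum_const, card_univ, nsmul_eq_mul, totalWeight,
    Complex.ofReal_sum, mul_sum]
  rw [sum_comm]

theorem map_univ_eq_of_totalWeight_eq {n n' : Λ → Fin (r + 1)}
    (hw : T.totalWeight n = T.totalWeight n') : univ.val.map n = univ.val.map n' := by
  -- The indicator of `k` is affine in the weights, so the total weight determines the number of
  -- sites in the state `k`.
  refine Multiset.ext.mpr fun k => ?_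
  obtain ⟨b, c, hbc⟩ := T.exists_affine (Pi.single k 1)
  have count (m : Λ → Fin (r + 1)) : ((univ.val.map m).count k : ℂ) =
      ∑ i, b i * (T.totalWeight m i : ℂ) + Fintype.card Λ * c := by
    rw [← sum_affine_eq]
    simp only [← hbc, Multiset.count_map, Pi.single_apply, sum_boole, eq_comm]
    rfl
  exact_mod_cast (count n).trans (hw ▸ (count n').symm)

variable [DecidableEq Λ]

theorem labelOp_level_mulVec (f : (Λ → Fin (r + 1)) → ℂ) {v : Fin d → ℂ} (hv : v ∈ T.vecSpace) :
    labelOp Λ T.level f *ᵥ tensorVec Λ d (fun _ => v) =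
      ∑ n, (f n * (T.braConf n ⬝ᵥ tensorVec Λ d fun _ => v)) • T.ketConf n := by
  rw [labelOp, Fintype.linearCombination_apply, sum_mulVec]
  refine sum_congr rfl fun n _ => ?_
  simp only [smul_mulVec, productOp_mulVec, T.level_mulVec hv]
  rw [(tensorVec Λ d).map_smul_univ, ← tensorVec_dotProduct, mul_smul]
  rfl

theorem braConf_dotProduct_eq_of_totalWeight_eq {n n' : Λ → Fin (r + 1)}
    (hw : T.totalWeight n = T.totalWeight n') (v : Fin d → ℂ) :
    (T.braConf n ⬝ᵥ tensorVec Λ d fun _ => v) = T.braConf n' ⬝ᵥ tensorVec Λ d fun _ => v := by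
  have prod_eq (m : Λ → Fin (r + 1)) : ∏ x, T.braVec (m x) ⬝ᵥ v =
      ((univ.val.map m).map fun k => T.braVec k ⬝ᵥ v).prod := by
    rw [Multiset.map_map]
    rfl
  rw [braConf, braConf, tensorVec_dotProduct, tensorVec_dotProduct, prod_eq, prod_eq,
    T.map_univ_eq_of_totalWeight_eq hw]

theorem cartanOn_univ_mulVec_ketConf (i : Fin r) (n : Λ → Fin (r + 1)) :
    T.cartanOn univ i *ᵥ T.ketConf n = (T.totalWeight n i : ℂ) • T.ketConf n := by
  rw [cartanOn, sum_mulVec, totalWeight, Complex.ofReal_sum, sum_smul]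
  refine sum_congr rfl fun x _ => ?_
  rw [ketConf, siteOp_mulVec, cartan_mulVec_ketVec, MultilinearMap.map_update_smul,
    update_eq_self (f := fun x => T.ketVec (n x))]

theorem braConf_vecMul_cartanOn_univ (i : Fin r) (n : Λ → Fin (r + 1)) :
    T.braConf n ᵥ* T.cartanOn univ i = (T.totalWeight n i : ℂ) • T.braConf n := by
  rw [cartanOn, vecMul_sum, totalWeight, Complex.ofReal_sum, sum_smul]
  refine sum_congr rfl fun x _ => ?_
  rw [braConf, vecMul_siteOp, braVec_vecMul_cartan, MultilinearMap.map_update_smul,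
    update_eq_self (f := fun x => T.braVec (n x))]

end Diagonal

section Amplitude

variable {d r : ℕ} (T : TargetSpace d r) {Λ : Type*} [Fintype Λ] [DecidableEq Λ]

/-- The sum of all on-site weight states, so that `⨂_x uniformVec` is the sum of all product basis
states of the target space. -/
def uniformVec : Fin d → ℂ := ∑ k, T.ketVec k

theorem uniformVec_mem_vecSpace : T.uniformVec ∈ T.vecSpace :=
  sum_mem fun k _ => T.ketVec_mem_vecSpace k

theorem tensorVec_uniformVec :
    tensorVec Λ d (fun _ => T.uniformVec) = ∑ n : Λ → Fin (r + 1), T.ketConf n :=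
  (tensorVec Λ d).map_sum fun _ => T.ketVec

theorem braVec_dotProduct_uniformVec (k : Fin (r + 1)) : T.braVec k ⬝ᵥ T.uniformVec = 1 := by
  simp [uniformVec, dotProduct_sum, braVec_dotProduct_ketVec]

/-- The amplitude `n ↦ ⟨n| O ∑_{n'} |n'⟩` of an operator `O`. If `O` preserves weights, then it acts
on the coherent states of the target space like the diagonal operator with entries
`amplitude O`. -/
def amplitude : Op Λ d →ₗ[ℂ] (Λ → Fin (r + 1)) → ℂ where
  toFun O n := T.braConf n ⬝ᵥ O *ᵥ tensorVec Λ d fun _ => T.uniformVec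
  map_add' O O' := by ext n; rw [add_mulVec, dotProduct_add]; rfl
  map_smul' a O := by ext n; rw [smul_mulVec, dotProduct_smul]; rfl

theorem amplitude_apply (O : Op Λ d) (n : Λ → Fin (r + 1)) :
    T.amplitude O n = T.braConf n ⬝ᵥ O *ᵥ tensorVec Λ d fun _ => T.uniformVec := rfl

theorem dependsOn_amplitude {X : Set Λ} {O : Op Λ d} (hO : O ∈ localAlgebra d X) :
    DependsOn (T.amplitude O) X := by
  classical
  obtain ⟨A, rfl⟩ := hO
  intro n n' hn
  have restrict_eq : (fun x : X => T.braVec (n x)) = fun x : X => T.braVec (n' x) :=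
    funext fun x => congrArg T.braVec (hn x x.2)
  simp only [amplitude_apply, braConf, tensorVec_dotProduct_embed_mulVec,
    braVec_dotProduct_uniformVec, restrict_eq]

theorem isSymmetric_amplitude {H : Op Λ d}
    (hscar : ∀ ψ ∈ T.scarSpace Λ, H *ᵥ ψ ∈ T.scarSpace Λ) : IsSymmetric (T.amplitude H) := by
  intro σ n
  have fixed := (T.mem_scarSpace_iff.mp
    (hscar _ (T.coherent_mem_scarSpace (Λ := Λ) T.uniformVec_mem_vecSpace))).2 σ
  rw [amplitude_apply, amplitude_apply, ← permute_dotProduct σ (T.braConf n), fixed]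
  congr 1
  exact (permute_tensorVec σ fun x => T.braVec (n x)).symm

theorem totalWeight_eq_of_braConf_dotProduct_ne_zero {O : Op Λ d}
    (hO : ∀ i, Commute O (T.cartanOn univ i)) {n n' : Λ → Fin (r + 1)}
    (hne : T.braConf n ⬝ᵥ O *ᵥ T.ketConf n' ≠ 0) : T.totalWeight n = T.totalWeight n' := by
  ext i
  have eq : T.totalWeight n i * (T.braConf n ⬝ᵥ O *ᵥ T.ketConf n') =
      T.totalWeight n' i * (T.braConf n ⬝ᵥ O *ᵥ T.ketConf n') := by
    calc T.totalWeight n i * (T.braConf n ⬝ᵥ O *ᵥ T.ketConf n')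
        = T.braConf n ⬝ᵥ (T.cartanOn univ i * O) *ᵥ T.ketConf n' := by
          rw [← mulVec_mulVec, dotProduct_mulVec _ (T.cartanOn univ i),
            braConf_vecMul_cartanOn_univ, smul_dotProduct, smul_eq_mul]
      _ = T.totalWeight n' i * (T.braConf n ⬝ᵥ O *ᵥ T.ketConf n') := by
          rw [← (hO i).eq, ← mulVec_mulVec, cartanOn_univ_mulVec_ketConf, mulVec_smul,
            dotProduct_smul, smul_eq_mul]
  exact_mod_cast mul_right_cancel₀ hne eq

theorem braConf_vecMul_projOn (X : Finset Λ) (n : Λ → Fin (r + 1)) :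
    T.braConf n ᵥ* T.projOn X = T.braConf n := by
  rw [braConf, projOn, vecMul_productOp]
  congr 1
  ext1 x
  split_ifs
  exacts [T.braVec_vecMul_proj _, vecMul_one _]

theorem cartanOn_mem_localAlgebra (X : Finset Λ) (i : Fin r) :
    T.cartanOn X i ∈ localAlgebra d (X : Set Λ) :=
  sum_mem fun x hx => localAlgebra_mono (Set.singleton_subset_iff.mpr hx)
    (siteOp_mem_localAlgebra x _)

theorem commute_cartanOn_univ {X : Finset Λ} {O : Op Λ d} (hO : O ∈ localAlgebra d (X : Set Λ))
    {i : Fin r} (hcomm : Commute O (T.cartanOn X i)) : Commute O (T.cartanOn univ i) := by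
  have split : T.cartanOn univ i = T.cartanOn X i + T.cartanOn Xᶜ i :=
    (sum_add_sum_compl X _).symm
  rw [split]
  exact hcomm.add_right (commute_of_disjoint (by rw [coe_compl]; exact disjoint_compl_right) hO
    (T.cartanOn_mem_localAlgebra Xᶜ i))

theorem totalWeight_eq_of_braConf_dotProduct_ne_zero_of_local {X : Finset Λ} {O : Op Λ d}
    (hO : O ∈ localAlgebra d (X : Set Λ))
    (hweight : ∀ i, Commute (T.projOn X * O * T.projOn X) (T.cartanOn X i))
    {n n' : Λ → Fin (r + 1)} (hne : T.braConf n ⬝ᵥ O *ᵥ T.ketConf n' ≠ 0) :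
    T.totalWeight n = T.totalWeight n' := by
  have projOn_mem := T.projOn_mem_localAlgebra X
  refine T.totalWeight_eq_of_braConf_dotProduct_ne_zero (O := T.projOn X * O * T.projOn X)
    (fun i => T.commute_cartanOn_univ (mul_mem (mul_mem projOn_mem hO) projOn_mem) (hweight i)) ?_
  rwa [← mulVec_mulVec, ketConf, T.projOn_mulVec_tensorVec X fun x => T.ketVec_mem_vecSpace (n' x),
    ← mulVec_mulVec, dotProduct_mulVec, braConf_vecMul_projOn]

theorem braConf_dotProduct_mulVec_tensorVec {X : Finset Λ} {O : Op Λ d}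
    (hO : O ∈ localAlgebra d (X : Set Λ))
    (hweight : ∀ i, Commute (T.projOn X * O * T.projOn X) (T.cartanOn X i))
    {v : Fin d → ℂ} (hv : v ∈ T.vecSpace) (n : Λ → Fin (r + 1)) :
    T.braConf n ⬝ᵥ O *ᵥ tensorVec Λ d (fun _ => v) =
      T.amplitude O n * (T.braConf n ⬝ᵥ tensorVec Λ d fun _ => v) := by
  calc T.braConf n ⬝ᵥ O *ᵥ tensorVec Λ d (fun _ => v)
      = ∑ n', (T.braConf n ⬝ᵥ O *ᵥ T.ketConf n') *
          (T.braConf n' ⬝ᵥ tensorVec Λ d fun _ => v) := by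
        conv_lhs => rw [← T.projOn_mulVec_tensorVec univ fun _ : Λ => hv, projOn_univ_mulVec]
        simp only [mulVec_sum, dotProduct_sum, mulVec_smul, dotProduct_smul, smul_eq_mul, mul_comm]
    _ = ∑ n', (T.braConf n ⬝ᵥ O *ᵥ T.ketConf n') *
          (T.braConf n ⬝ᵥ tensorVec Λ d fun _ => v) := by
        refine sum_congr rfl fun n' _ => ?_
        by_cases hne : T.braConf n ⬝ᵥ O *ᵥ T.ketConf n' = 0
        · rw [hne, zero_mul, zero_mul]
        · rw [T.braConf_dotProduct_eq_of_totalWeight_eq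
            (T.totalWeight_eq_of_braConf_dotProduct_ne_zero_of_local hO hweight hne)]
    _ = T.amplitude O n * (T.braConf n ⬝ᵥ tensorVec Λ d fun _ => v) := by
        rw [amplitude_apply, tensorVec_uniformVec, mulVec_sum, dotProduct_sum, sum_mul]

theorem projOn_mul_mulVec_tensorVec {X : Finset Λ} {O : Op Λ d}
    (hO : O ∈ localAlgebra d (X : Set Λ))
    (hweight : ∀ i, Commute (T.projOn X * O * T.projOn X) (T.cartanOn X i))
    {v : Fin d → ℂ} (hv : v ∈ T.vecSpace) :
    (T.projOn X * O) *ᵥ tensorVec Λ d (fun _ => v) =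
      labelOp Λ T.level (T.amplitude O) *ᵥ tensorVec Λ d fun _ => v := by
  rw [← mulVec_mulVec, ← leakSector_empty,
    ← T.leakSector_univ_mulVec_of_subset (empty_subset X) hO fun _ => hv, leakSector_empty,
    projOn_univ_mulVec, T.labelOp_level_mulVec _ hv]
  simp only [T.braConf_dotProduct_mulVec_tensorVec hO hweight hv]

variable {T} {G : SimpleGraph Λ} {h : Finset Λ → Op Λ d}

theorem projOn_mul_sub_labelOp_mem_decomposable (hloc : IsLocal G h) {X : Finset Λ}
    (hweight : ∀ i, Commute (T.projOn X * h X * T.projOn X) (T.cartanOn X i)) :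
    T.projOn X * h X - labelOp Λ T.level (T.amplitude (h X)) ∈
      T.decomposable G (interactionHull h) := by
  obtain h0 | h0 := eq_or_ne (h X) 0
  · rw [h0, mul_zero, map_zero, map_zero, sub_zero]
    exact zero_mem _
  have hX := hloc.supported X
  refine mem_decomposable_of_connected (hloc.connected X h0) ?_ ?_ ?_
  · exact fun x hx z hz => ⟨X, X, h0, h0, hx, hz, x, hx, hx⟩
  · exact sub_mem (mul_mem (T.projOn_mem_localAlgebra X) hX)
      (labelOp_mem_localAlgebra T.sum_level (T.dependsOn_amplitude hX))
  · exact T.mem_coherentAnnihilator.mpr fun v hv => by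
      rw [sub_mulVec, T.projOn_mul_mulVec_tensorVec hX hweight hv, sub_self]

theorem exists_amplitude_eq_sum (hloc : IsLocal G h)
    (hscar : ∀ ψ ∈ T.scarSpace Λ, (∑ X, h X) *ᵥ ψ ∈ T.scarSpace Λ) :
    ∃ ε : Fin (r + 1) → ℂ, ∀ n, T.amplitude (∑ X, h X) n = ∑ x, ε (n x) := by
  obtain _ | _ := isEmpty_or_nonempty Λ
  · have h0 (X : Finset Λ) : h X = 0 := by
      by_contra hX
      exact isEmptyElim (hloc.connected X hX).nonempty.some.1
    exact ⟨0, fun n => by simp [h0]⟩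
  have symmetric := T.isSymmetric_amplitude hscar
  refine exists_eq_sum_of_isSymmetric symmetric fun x y hxy => ?_
  obtain ⟨x₀, y₀, hxy₀, hregion⟩ := hloc.not_all_to_all ⟨x, y, hxy⟩
  refine Uncorrelated.of_isSymmetric symmetric ?_ hxy₀ hxy
  rw [map_sum]
  refine Uncorrelated.sum fun X _ => ?_
  obtain h0 | h0 := eq_or_ne (h X) 0
  · have : DependsOn (T.amplitude (h X)) ∅ := fun n n' _ => by simp [h0]
    exact uncorrelated_of_dependsOn this hxy₀ (by simp)
  · exact uncorrelated_of_dependsOn (T.dependsOn_amplitude (hloc.supported X)) hxy₀ (hregion X h0)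

end Amplitude

section Zeeman

variable {d r : ℕ} (T : TargetSpace d r) {Λ : Type*} [Fintype Λ] [DecidableEq Λ]

theorem zeeman_eq_sum_siteOp (b : Fin r → ℂ) (c : ℂ) :
    T.zeeman Λ b c = ∑ x, siteOp x (∑ i, b i • T.cartan i + c • 1) := by
  simp only [zeeman, ← siteOpHom_apply, map_add, map_sum, map_smul, map_one]

theorem zeeman_eq_sum_cartanOn (b : Fin r → ℂ) (c : ℂ) :
    T.zeeman Λ b c = ∑ i, b i • T.cartanOn univ i + (Fintype.card Λ * c) • 1 := by
  simp only [zeeman, cartanOn, sum_add_distrib, smul_sum]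
  rw [sum_comm, sum_const, card_univ, mul_smul, Nat.cast_smul_eq_nsmul]

theorem zeeman_mulVec_weightState (b : Fin r → ℂ) (c : ℂ) (k : Λ → Fin (r + 1)) :
    T.zeeman Λ b c *ᵥ T.weightState k =
      (∑ i, b i * (T.totalWeight k i : ℂ) + Fintype.card Λ * c) • T.weightState k := by
  have totalWeight_perm (σ : Equiv.Perm Λ) : T.totalWeight (k ∘ σ) = T.totalWeight k :=
    funext fun i => Equiv.sum_comp σ fun x => T.weight (k x) i
  have cartanOn_mulVec (i : Fin r) : T.cartanOn univ i *ᵥ T.weightState k =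
      (T.totalWeight k i : ℂ) • T.weightState k := by
    simp only [weightState_eq_sum_ketConf, mulVec_sum, cartanOn_univ_mulVec_ketConf,
      totalWeight_perm, smul_sum]
  simp only [zeeman_eq_sum_cartanOn, add_mulVec, sum_mulVec, smul_mulVec, cartanOn_mulVec,
    one_mulVec, smul_smul, add_smul, sum_smul]

theorem sum_smul_cartan (b : Fin r → ℂ) :
    ∑ i, b i • T.cartan i = ∑ k, (∑ i, b i * (T.weight k i : ℂ)) • T.dyad k := by
  simp only [cartan, smul_sum, smul_smul, sum_smul]
  exact sum_comm

theorem labelOp_level_sub_zeeman {b : Fin r → ℂ} {c : ℂ} {ε : Fin (r + 1) → ℂ}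
    (hε : ∀ k, ε k = ∑ i, b i * (T.weight k i : ℂ) + c) :
    labelOp Λ T.level (fun n => ∑ x, ε (n x)) - T.zeeman Λ b c =
      ∑ x, (ε 0 - c) • T.leakProj x := by
  rw [labelOp_sum T.sum_level, zeeman_eq_sum_siteOp, ← sum_sub_distrib]
  refine sum_congr rfl fun x _ => ?_
  have on_site : ∑ k, ε k • T.level k - (∑ i, b i • T.cartan i + c • 1) =
      (ε 0 - c) • (1 - T.proj) := by
    have sum_dyad : ∑ k, ε k • T.dyad k = ∑ i, b i • T.cartan i + c • T.proj := by
      simp only [hε, add_smul, sum_add_distrib, sum_smul_cartan, proj, smul_sum]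
    rw [sum_smul_level, sum_dyad]
    module
  rw [leakProj, ← siteOpHom_apply, ← siteOpHom_apply, ← siteOpHom_apply, ← map_sub, ← map_smul,
    on_site]

theorem weightState_const_ne_zero (j : Fin (r + 1)) : T.weightState (fun _ : Λ => j) ≠ 0 := by
  have overlap : T.braConf (fun _ => j) ⬝ᵥ T.weightState (fun _ : Λ => j) =
      (Fintype.card Λ).factorial := by
    simp only [weightState_eq_sum_ketConf, braConf, ketConf, Function.comp_apply, sum_const,
      card_univ, Fintype.card_perm, dotProduct_smul, tensorVec_dotProduct, braVec_dotProduct_ketVec,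
      ↓reduceIte, prod_const_one, nsmul_one]
  intro h0
  rw [h0, dotProduct_zero] at overlap
  exact Nat.factorial_ne_zero _ (Nat.cast_eq_zero.mp overlap.symm)

theorem star_coefficients_eq_self [Nonempty Λ] {b : Fin r → ℂ} {c : ℂ} {H : Op Λ d}
    (hH : H.IsHermitian) (heig : ∀ k : Λ → Fin (r + 1), H *ᵥ T.weightState k =
      (∑ i, b i * (T.totalWeight k i : ℂ) + Fintype.card Λ * c) • T.weightState k) :
    star b = b ∧ star c = c := by
  have real (j : Fin (r + 1)) : star (∑ i, b i * (T.weight j i : ℂ) + c) =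
      ∑ i, b i * (T.weight j i : ℂ) + c := by
    have energy := star_eq_self_of_isHermitian hH (heig fun _ => j) (T.weightState_const_ne_zero j)
    rw [← sum_affine_eq, sum_const, card_univ, nsmul_eq_mul, star_mul', star_natCast] at energy
    exact mul_left_cancel₀ (Nat.cast_ne_zero.mpr Fintype.card_ne_zero) energy
  obtain ⟨hb, hc⟩ := T.affine_eq_zero (b := star b - b) (c := star c - c) fun k => by
    rw [← sub_eq_zero.mpr (real k)]
    simp only [Pi.sub_apply, Pi.star_apply, sub_mul, sum_sub_distrib, star_add, star_sum, star_mul',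
      Complex.star_def, Complex.conj_ofReal]
    ring
  exact ⟨sub_eq_zero.mp hb, sub_eq_zero.mp hc⟩

theorem isHermitian_zeeman {b : Fin r → ℂ} {c : ℂ} {H : Op Λ d} (hH : H.IsHermitian)
    (heig : ∀ k : Λ → Fin (r + 1), H *ᵥ T.weightState k =
      (∑ i, b i * (T.totalWeight k i : ℂ) + Fintype.card Λ * c) • T.weightState k) :
    (T.zeeman Λ b c).IsHermitian := by
  obtain _ | _ := isEmpty_or_nonempty Λ
  · simp [zeeman]
  obtain ⟨hb, hc⟩ := T.star_coefficients_eq_self hH heig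
  simp only [IsHermitian, zeeman_eq_sum_siteOp, conjTranspose_sum, siteOp_conjTranspose,
    conjTranspose_add, conjTranspose_smul, cartan_conjTranspose, conjTranspose_one, hc,
    show ∀ i, star (b i) = b i from congr_fun hb]

variable {T} {G : SimpleGraph Λ} {h : Finset Λ → Op Λ d}

theorem exists_sub_zeeman_mem_decomposable (hloc : IsLocal G h)
    (hscar : ∀ ψ ∈ T.scarSpace Λ, (∑ X, h X) *ᵥ ψ ∈ T.scarSpace Λ)
    (hweight : ∀ (X : Finset Λ) (i : Fin r),
      Commute (T.projOn X * h X * T.projOn X) (T.cartanOn X i)) :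
    ∃ (b : Fin r → ℂ) (c : ℂ),
      ∑ X, h X - T.zeeman Λ b c ∈ T.decomposable G (interactionHull h) := by
  obtain ⟨ε, hε⟩ := exists_amplitude_eq_sum hloc hscar
  obtain ⟨b, c, hbc⟩ := T.exists_affine ε
  have diagonal : ∑ X, T.projOn X * h X - labelOp Λ T.level (fun n => ∑ x, ε (n x)) ∈
      T.decomposable G (interactionHull h) := by
    rw [← funext hε, map_sum, map_sum, ← sum_sub_distrib]
    exact sum_mem fun X _ => projOn_mul_sub_labelOp_mem_decomposable hloc (hweight X)
  have onSite : labelOp Λ T.level (fun n => ∑ x, ε (n x)) - T.zeeman Λ b c ∈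
      T.decomposable G (interactionHull h) := by
    rw [T.labelOp_level_sub_zeeman hbc]
    refine sum_mem fun x _ => Submodule.smul_mem _ _ ?_
    rw [← one_mul (T.leakProj x)]
    exact mul_leakProj_mem_decomposable (one_mem _)
  refine ⟨b, c, ?_⟩
  simpa only [sub_add_sub_cancel] using
    add_mem (add_mem (sum_sub_sum_projOn_mul_mem_decomposable hloc hscar) diagonal) onSite

end Zeeman

end TargetSpace

end FerroScar

theorem mainTheorem5 {Λ : Type*} [Fintype Λ] [DecidableEq Λ] (G : SimpleGraph Λ)
    [DecidableRel G.Adj] {d r : ℕ} (T : TargetSpace d r)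
    (h : Finset Λ → Op Λ d) (H : Op Λ d) (hH : H = ∑ X, h X)
    (hloc : IsLocal G h)
    (heig : ∀ k : Λ → Fin (r + 1), ∃ E : ℂ, H.mulVec (T.weightState k) = E • T.weightState k)
    (hweight : ∀ (X : Finset Λ) (i : Fin r),
      Commute (T.projOn X * h X * T.projOn X) (T.cartanOn X i)) :
    ∃ (P₁ h₁ : Λ → Op Λ d) (P₂ h₂ : Sym2 Λ → Op Λ d) (b : Fin r → ℂ) (c : ℂ),
      H = ∑ x, h₁ x * P₁ x + ∑ e ∈ G.edgeFinset, h₂ e * P₂ e + T.zeeman Λ b c ∧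
      (∀ x, T.IsLocalAnnihilatingProjector {x} (P₁ x)) ∧
      (∀ e ∈ G.edgeFinset, T.IsLocalAnnihilatingProjector {z | z ∈ e} (P₂ e)) ∧
      (∀ x, SupportedOn (interactionHull h x) (h₁ x)) ∧
      (∀ e ∈ G.edgeFinset, SupportedOn {z | ∀ x ∈ e, z ∈ interactionHull h x} (h₂ e)) ∧
      (H.IsHermitian → (T.zeeman Λ b c).IsHermitian) ∧
      ∀ k : Λ → Fin (r + 1), ∃ E : ℂ,
        E = ∑ i, b i * (T.totalWeight k i : ℂ) + Fintype.card Λ * c ∧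
        (T.zeeman Λ b c).mulVec (T.weightState k) = E • T.weightState k ∧
        H.mulVec (T.weightState k) = E • T.weightState k := by
  subst hH
  obtain ⟨b, c, hmem⟩ := TargetSpace.exists_sub_zeeman_mem_decomposable hloc
    (fun _ => T.mulVec_mem_scarSpace heig) hweight
  obtain ⟨h₁, h₂, hdec, hlocal₁, hlocal₂⟩ := TargetSpace.exists_eq_sum_of_mem_decomposable hmem
  have energy (k : Λ → Fin (r + 1)) : (∑ X, h X).mulVec (T.weightState k) =
      (∑ i, b i * (T.totalWeight k i : ℂ) + Fintype.card Λ * c) • T.weightState k := by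
    have annihilated := TargetSpace.mulVec_eq_zero_of_mem_decomposable hmem
      (T.mem_symSpace_of_mem_scarSpace (T.weightState_mem_scarSpace k))
    rw [Matrix.sub_mulVec, sub_eq_zero] at annihilated
    rw [annihilated, T.zeeman_mulVec_weightState]
  exact ⟨T.leakProj, h₁, edgeProj Λ d, h₂, b, c, sub_eq_iff_eq_add.mp hdec,
    T.isLocalAnnihilatingProjector_leakProj,
    fun e _ => T.isLocalAnnihilatingProjector_edgeProj e, hlocal₁, fun e _ => hlocal₂ e,
    fun hHerm => T.isHermitian_zeeman hHerm energy,
    fun k => ⟨_, rfl, T.zeeman_mulVec_weightState b c k, energy k⟩⟩
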